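/- Let $\mathcal L_{\mathrm{ri}}=\{+,\cdot,-,0,1\}$ be the language of unital rings, let $n\ge 1$, and let $F$ be a (commutative) field. Let $\tilde F$ be an expansion of $F$ in some first-order language $\mathcal L$ extending $\mathcal L_{\mathrm{ri}}$. Let $M_n(\tilde F)$ be the $\mathcal L$-structure that expands the ring $M_n(F)$ of $n\times n$ matrices as follows, where the center $C=F\cdot I_n$ of $M_n(F)$ is identified with $F$ via $a\mapsto a I_n$: every symbol of $\mathcal L\setminus\mathcal L_{\mathrm{ri}}$ that is a relation symbol is interpreted by the relation on $C$ given by $\tilde F$ (so it holds only for tuples from $C$); every constant symbol is interpreted by the element of $C$ given by $\tilde F$; and every $m$-ary function symbol is interpreted on $C^m$ by the function given by $\tilde F$ and takes the value $0$ on all tuples outside $C^m$. A tuple of matrix units in $M_n(F)$ is a tuple $\bar e=(e_{ij})_{1\le i,j\le n}$ of elements of $M_n(F)$ such that, for all $i,j,s,t$, $e_{ij}\ne 0$, $e_{ij}e_{jt}=e_{it}$, and $e_{ij}e_{st}=0$ if $j\ne s$. A structure has quantifier elimination if every formula $\varphi(\bar x)$ of its language is equivalent in the structure to a quantifier-free formula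 $\psi(\bar x)$ in the same free variables. Suppose that $\tilde F$ has quantifier elimination in $\mathcal L$. Let $\bar c=(c_{ij})_{1\le i,j\le n}$ be new constant symbols and let $\bar e$ be any tuple of matrix units in $M_n(F)$. Then the $\mathcal L(\bar c)$-structure $(M_n(\tilde F),\bar e)$, in which $c_{ij}$ is interpreted by $e_{ij}$, has quantifier elimination. In particular, for every $n\ge 1$, the ring $M_n(\mathbb C)$ expanded by constants for the standard matrix units $E_{ij}$ has quantifier elimination, and the ring $M_n(\mathbb R)$ expanded by the natural order on its center $\mathbb R\cdot I_n$ and by constants for the standard matrix units $E_{ij}$ has quantifier elimination. -/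

import Mathlib

universe u v w

namespace MatrixQE

/-- A first-order structure has quantifier elimination: every formula in finitely many free
variables is equivalent, in the structure, to a quantifier-free formula in the same variables. -/
def HasQE {L : FirstOrder.Language.{u, v}} {M : Type w} (S : L.Structure M) : Prop :=
  letI := S
  ∀ (k : ℕ) (φ : L.Formula (Fin k)), ∃ ψ : L.Formula (Fin k),
    ψ.IsQF ∧ ∀ x : Fin k → M, φ.Realize x ↔ ψ.Realize x

/-- A ring as a structure in the language `{+, ·, -, 0, 1}` of unital rings. -/
abbrev ringStructure (R : Type w) [Ring R] : FirstOrder.Language.ring.Structure R :=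
  (FirstOrder.Ring.compatibleRingOfRing R).toStructure

/-- The expansion of a ring `R` by the interpretation `S` of a language `L` of new symbols.
A language extending the language of rings is the disjoint union of the language of rings and the
language of its new symbols. -/
abbrev ringExpansion {L : FirstOrder.Language.{u, v}} (R : Type w) [Ring R] (S : L.Structure R) :
    (FirstOrder.Language.ring.sum L).Structure R :=
  letI := ringStructure R
  letI := S
  FirstOrder.Language.sumStructure FirstOrder.Language.ring L R

/-- `a` is the tuple of field elements corresponding to the tuple `A` of central elements of the
matrix ring. The center of the matrix ring consists of the scalar matrices and it is identified
with the field via `a ↦ a • I`. -/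
def IsCentralTuple {F : Type w} [Field F] {n k : ℕ}
    (A : Fin k → Matrix (Fin n) (Fin n) F) (a : Fin k → F) : Prop :=
  ∀ i, A i = Matrix.scalar (Fin n) (a i)

open Classical in
/-- The interpretation of the new symbols on `n × n` matrices: a relation symbol holds only for
tuples of central elements, as given by the field; a function symbol is on tuples of central
elements as given by the field, and `0` on all other tuples. -/
noncomputable abbrev centerStructure {L : FirstOrder.Language.{u, v}} {F : Type w} [Field F]
    (S : L.Structure F) (n : ℕ) : L.Structure (Matrix (Fin n) (Fin n) F) where
  funMap f A :=
    if h : ∃ a, IsCentralTuple A a then Matrix.scalar (Fin n) (S.funMap f h.choose) else 0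
  RelMap R A := ∃ a, IsCentralTuple A a ∧ S.RelMap R a

/-- The structure on `n × n` matrices over an expansion of a field `F`, where `S` is the
interpretation in `F` of the new symbols. -/
noncomputable abbrev matrixExpansion {L : FirstOrder.Language.{u, v}} {F : Type w} [Field F]
    (S : L.Structure F) (n : ℕ) :
    (FirstOrder.Language.ring.sum L).Structure (Matrix (Fin n) (Fin n) F) :=
  ringExpansion (Matrix (Fin n) (Fin n) F) (centerStructure S n)

/-- The expansion of a structure by new constant symbols `c i j`, interpreted by `e i j`. -/
abbrev nameConstants {L : FirstOrder.Language.{u, v}} {M : Type w} (S : L.Structure M) {n : ℕ}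
    (e : Fin n → Fin n → M) : (L.withConstants (Fin n × Fin n)).Structure M :=
  letI := S
  letI := FirstOrder.Language.constantsOn.structure fun p : Fin n × Fin n => e p.1 p.2
  FirstOrder.Language.sumStructure L (FirstOrder.Language.constantsOn (Fin n × Fin n)) M

/-- A tuple of `n × n` matrix units in a ring. -/
structure IsMatrixUnits {R : Type w} [Ring R] {n : ℕ} (e : Fin n → Fin n → R) : Prop where
  mul_same : ∀ i j t, e i j * e j t = e i t
  mul_of_ne : ∀ i j s t, j ≠ s → e i j * e s t = 0
  ne_zero : ∀ i j, e i j ≠ 0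

/-- The standard matrix units `E i j`. -/
abbrev stdUnits (F : Type w) [Field F] (n : ℕ) (i j : Fin n) : Matrix (Fin n) (Fin n) F :=
  Matrix.single i j 1

end MatrixQE

/-!
The linear map sending `E i j` to `e i j` is an automorphism of the `F`-algebra of matrices, so the
matrix units may be taken standard. Written in terms of entries, a formula about matrices becomes a
formula about elements of `F`, which quantifier elimination in `F` makes quantifier-free. It can be
read back in the matrix ring without quantifiers because the entry `A i j`, as a scalar matrix, is
the value of the term `∑ t, E t i * A * E j t`.

For `ℂ` and `ℝ` with its order, quantifier elimination says that the zero patterns, respectively the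
sign patterns, attained by finitely many polynomials in one variable depend only on the zeros,
respectively signs, of finitely many expressions in their coefficients. Close the set of polynomials
under erasing leading terms, derivatives and pseudo-remainders. Over `ℝ`, two specializations of
such a set whose leading coefficients have the same signs are matched by an order isomorphism of
the line, built by adding polynomials in the order of their degrees: the new polynomial is monotone
between roots of the earlier ones, and its sign at such a root is that of a pseudo-remainder. Over
an algebraically closed field, a polynomial `d` of positive degree has a root that is not a root of
`g` unless `d` divides `g ^ d.natDegree`, and this is decided by a pseudo-remainder.
-/

namespace MatrixQE

open Polynomial Set Filter
open SignType (sign)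

/-! ### Polynomial functions on the real line -/

theorem exists_orderIso_map_eq_of_le {a b w v : ℝ} (haw : a < w) (hvb : v < b) (hwv : w ≤ v) :
    ∃ k : ℝ ≃o ℝ, (∀ x, x ∉ Ioo a b → k x = x) ∧ k w = v := by
  have hwb : w < b := hwv.trans_lt hvb
  have hs : 1 ≤ (v - a) / (w - a) := (one_le_div (sub_pos.2 haw)).2 (by linarith)
  have ht : 0 < (b - v) / (b - w) := div_pos (sub_pos.2 hvb) (sub_pos.2 hwb)
  have ht' : (b - v) / (b - w) ≤ 1 := (div_le_one (sub_pos.2 hwb)).2 (by linarith)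
  have hsv : (v - a) / (w - a) * (w - a) = v - a := div_mul_cancel₀ _ (sub_pos.2 haw).ne'
  have htv : (b - v) / (b - w) * (b - w) = b - v := div_mul_cancel₀ _ (sub_pos.2 hwb).ne'
  set s := (v - a) / (w - a)
  set t := (b - v) / (b - w)
  -- Above the diagonal, `k` is the broken line through `(a, a)`, `(w, v)` and `(b, b)`.
  let k : ℝ → ℝ := fun x => max x (min (a + s * (x - a)) (b + t * (x - b)))
  have hk : StrictMono k := fun x y hxy => max_lt_max hxy <| min_lt_min
    (by gcongr) (by gcongr)
  have hfix : ∀ x, x ∉ Ioo a b → k x = x := by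
    intro x hx
    rcases not_and_or.1 hx with hx | hx <;> rw [not_lt] at hx
    · exact max_eq_left ((min_le_left _ _).trans (by nlinarith))
    · exact max_eq_left ((min_le_right _ _).trans (by nlinarith))
  have hsurj : Function.Surjective k := by
    refine Continuous.surjective (by fun_prop) (tendsto_id.congr' ?_) (tendsto_id.congr' ?_)
    · filter_upwards [eventually_ge_atTop b] with x hx using (hfix x fun h => h.2.not_ge hx).symm
    · filter_upwards [eventually_le_atBot a] with x hx using (hfix x fun h => h.1.not_ge hx).symm
  refine ⟨hk.orderIsoOfSurjective k hsurj, hfix, ?_⟩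
  change max w (min (a + s * (w - a)) (b + t * (w - b))) = v
  rw [hsv, show b + t * (w - b) = v by linarith, add_sub_cancel, min_self, max_eq_right hwv]

theorem exists_orderIso_map_eq {a b w v : ℝ} (hw : w ∈ Ioo a b) (hv : v ∈ Ioo a b) :
    ∃ k : ℝ ≃o ℝ, (∀ x, x ∉ Ioo a b → k x = x) ∧ k w = v := by
  rcases le_total w v with h | h
  · exact exists_orderIso_map_eq_of_le hw.1 hv.2 h
  · obtain ⟨k, hk, hkv⟩ := exists_orderIso_map_eq_of_le hv.1 hw.2 h
    exact ⟨k.symm, fun x hx => k.symm_apply_eq.2 (hk x hx).symm, k.symm_apply_eq.2 hkv.symm⟩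

theorem pos_iff_pos_of_sign_eq {x y : ℝ} (h : sign x = sign y) : 0 < x ↔ 0 < y := by
  rw [← sign_eq_one_iff, h, sign_eq_one_iff]

theorem neg_iff_neg_of_sign_eq {x y : ℝ} (h : sign x = sign y) : x < 0 ↔ y < 0 := by
  rw [← sign_eq_neg_one_iff, h, sign_eq_neg_one_iff]

theorem sign_eq_of_isPreconnected {f : ℝ → ℝ} {s : Set ℝ} (hs : IsPreconnected s)
    (hf : ContinuousOn f s) (h0 : ∀ x ∈ s, f x ≠ 0) {x y : ℝ} (hx : x ∈ s) (hy : y ∈ s) :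
    sign (f x) = sign (f y) :=
  hs.constant_of_mapsTo IsDiscrete.univ
    (fun z hz => (continuousAt_sign_of_ne_zero (h0 z hz)).comp_continuousWithinAt (hf z hz))
    (mapsTo_univ _ _) hx hy

theorem sign_apply_orderIso {f : ℝ → ℝ} (hf : Continuous f) {k : ℝ ≃o ℝ}
    (hk : ∀ x, f x = 0 → k x = x) (x : ℝ) : sign (f (k x)) = sign (f x) := by
  rcases eq_or_ne (k x) x with hx | hx
  · rw [hx]
  refine sign_eq_of_isPreconnected isPreconnected_uIcc hf.continuousOn (fun t ht h0 => ?_)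
    (right_mem_uIcc (a := x)) left_mem_uIcc
  have hxt : x ≠ t := fun h => hx (hk x (h ▸ h0))
  rcases mem_uIcc.1 ht with ⟨h₁, h₂⟩ | ⟨h₁, h₂⟩
  · exact (k.strictMono (h₁.lt_of_ne hxt)).not_ge (by rwa [hk t h0])
  · exact (k.strictMono (h₂.lt_of_ne hxt.symm)).not_ge (by rwa [hk t h0])

/-- `f` has the same signs on `[a, b]` as `g` after a change of variables of the line that fixes
the points of `Z` and everything outside `(a, b)`. -/
def SignMatchOn (f g : ℝ → ℝ) (Z : Set ℝ) (a b : ℝ) : Prop :=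
  ∃ k : ℝ ≃o ℝ, (∀ x, x ∉ Ioo a b → k x = x) ∧ (∀ z ∈ Z, k z = z) ∧
    ∀ x ∈ Icc a b, sign (f x) = sign (g (k x))

namespace SignMatchOn

variable {f g : ℝ → ℝ} {Z : Set ℝ} {a b c : ℝ}

theorem trans (hab : a ≤ b) (hbc : b ≤ c) (h₁ : SignMatchOn f g Z a b)
    (h₂ : SignMatchOn f g Z b c) : SignMatchOn f g Z a c := by
  obtain ⟨k₁, hfix₁, hZ₁, hk₁⟩ := h₁
  obtain ⟨k₂, hfix₂, hZ₂, hk₂⟩ := h₂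
  have hle : ∀ x ≤ b, k₁ x ≤ b := fun x hx =>
    (k₁.monotone hx).trans_eq (hfix₁ b fun h => lt_irrefl _ h.2)
  refine ⟨k₁.trans k₂, fun x hx => ?_, fun z hz => ?_, fun x hx => ?_⟩
  · rw [OrderIso.trans_apply, hfix₁ x fun h => hx ⟨h.1, h.2.trans_le hbc⟩,
      hfix₂ x fun h => hx ⟨hab.trans_lt h.1, h.2⟩]
  · rw [OrderIso.trans_apply, hZ₁ z hz, hZ₂ z hz]
  · rw [OrderIso.trans_apply]
    rcases le_total x b with hxb | hbx
    · rw [hfix₂ _ fun h => (hle x hxb).not_gt h.1, hk₁ x ⟨hx.1, hxb⟩]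
    · rw [hfix₁ x fun h => hbx.not_gt h.2, hk₂ x ⟨hbx, hx.2⟩]

theorem neg (h : SignMatchOn (-f) (-g) Z a b) : SignMatchOn f g Z a b := by
  obtain ⟨k, hfix, hZ, hk⟩ := h
  refine ⟨k, hfix, hZ, fun x hx => neg_injective ?_⟩
  rw [← Left.sign_neg, ← Left.sign_neg]
  exact hk x hx

theorem of_sign_eq (h : ∀ x ∈ Icc a b, sign (f x) = sign (g x)) : SignMatchOn f g Z a b :=
  ⟨OrderIso.refl ℝ, fun _ _ => rfl, fun _ _ => rfl, h⟩

theorem of_zero (hf : StrictMonoOn f (Icc a b)) (hg : StrictMonoOn g (Icc a b))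
    (hZ : Disjoint (Ioo a b) Z) {w v : ℝ} (hw : w ∈ Ioo a b) (hv : v ∈ Ioo a b) (hfw : f w = 0)
    (hgv : g v = 0) : SignMatchOn f g Z a b := by
  obtain ⟨k, hfix, hkw⟩ := exists_orderIso_map_eq hw hv
  refine ⟨k, hfix, fun z hz => hfix z fun h => hZ.notMem_of_mem_left h hz, fun x hx => ?_⟩
  have hkx : k x ∈ Icc a b := by
    rw [← hfix a fun h => lt_irrefl _ h.1, ← hfix b fun h => lt_irrefl _ h.2]
    exact ⟨k.monotone hx.1, k.monotone hx.2⟩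
  have hw' := Ioo_subset_Icc_self hw
  have hv' := Ioo_subset_Icc_self hv
  rcases lt_trichotomy x w with h | rfl | h
  · rw [sign_neg (hfw ▸ hf hx hw' h), sign_neg (hgv ▸ hg hkx hv' (hkw ▸ k.strictMono h))]
  · rw [hkw, hfw, hgv]
  · rw [sign_pos (hfw ▸ hf hw' hx h), sign_pos (hgv ▸ hg hv' hkx (hkw ▸ k.strictMono h))]

theorem of_strictMonoOn (hab : a ≤ b) (hfc : ContinuousOn f (Icc a b))
    (hgc : ContinuousOn g (Icc a b)) (hf : StrictMonoOn f (Icc a b))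
    (hg : StrictMonoOn g (Icc a b)) (hZ : Disjoint (Ioo a b) Z) (ha : sign (f a) = sign (g a))
    (hb : sign (f b) = sign (g b)) : SignMatchOn f g Z a b := by
  have ha' := left_mem_Icc.2 hab
  have hb' := right_mem_Icc.2 hab
  rcases le_or_gt 0 (f a) with hfa | hfa
  · have hga : 0 ≤ g a := not_lt.1 fun h => hfa.not_gt ((neg_iff_neg_of_sign_eq ha).2 h)
    refine of_sign_eq fun x hx => ?_
    rcases hx.1.eq_or_lt with rfl | hax
    · exact ha
    · rw [sign_pos (hfa.trans_lt (hf ha' hx hax)), sign_pos (hga.trans_lt (hg ha' hx hax))]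
  rcases le_or_gt (f b) 0 with hfb | hfb
  · have hgb : g b ≤ 0 := not_lt.1 fun h => hfb.not_gt ((pos_iff_pos_of_sign_eq hb).2 h)
    refine of_sign_eq fun x hx => ?_
    rcases hx.2.eq_or_lt with rfl | hxb
    · exact hb
    · rw [sign_neg ((hf hx hb' hxb).trans_le hfb), sign_neg ((hg hx hb' hxb).trans_le hgb)]
  obtain ⟨w, hw, hfw⟩ := intermediate_value_Ioo hab hfc ⟨hfa, hfb⟩
  obtain ⟨v, hv, hgv⟩ := intermediate_value_Ioo hab hgc
    ⟨(neg_iff_neg_of_sign_eq ha).1 hfa, (pos_iff_pos_of_sign_eq hb).1 hfb⟩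
  exact of_zero hf hg hZ hw hv hfw hgv

theorem of_piecewise_strictMonoOn (hfc : Continuous f) (hgc : Continuous g) (hZ : Z.Finite)
    (hmono : ∀ a b, Disjoint (Ioo a b) Z →
      StrictMonoOn f (Icc a b) ∧ StrictMonoOn g (Icc a b) ∨
        StrictAntiOn f (Icc a b) ∧ StrictAntiOn g (Icc a b))
    (hsign : ∀ z ∈ Z, sign (f z) = sign (g z)) (hab : a ≤ b) (ha : sign (f a) = sign (g a))
    (hb : sign (f b) = sign (g b)) : SignMatchOn f g Z a b := by
  induction hn : (Ioo a b ∩ Z).ncard using Nat.strong_induction_on generalizing a b with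
  | _ n ih =>
    have hfin : (Ioo a b ∩ Z).Finite := hZ.inter_of_right _
    rcases (Ioo a b ∩ Z).eq_empty_or_nonempty with hempty | ⟨z, hz, hzZ⟩
    · have hdisj := disjoint_iff_inter_eq_empty.2 hempty
      rcases hmono a b hdisj with ⟨hf, hg⟩ | ⟨hf, hg⟩
      · exact of_strictMonoOn hab hfc.continuousOn hgc.continuousOn hf hg hdisj ha hb
      · refine (of_strictMonoOn hab hfc.neg.continuousOn hgc.neg.continuousOn hf.neg hg.neg
          hdisj ?_ ?_).neg <;> simpa only [Pi.neg_apply, Left.sign_neg, neg_inj]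
    · refine trans hz.1.le hz.2.le (ih _ ?_ hz.1.le ha (hsign z hzZ) rfl)
        (ih _ ?_ hz.2.le (hsign z hzZ) hb rfl)
      · rw [← hn]
        refine ncard_lt_ncard ⟨inter_subset_inter_left _ (Ioo_subset_Ioo_right hz.2.le),
          fun h => ?_⟩ hfin
        exact lt_irrefl _ (h ⟨hz, hzZ⟩).1.2
      · rw [← hn]
        refine ncard_lt_ncard ⟨inter_subset_inter_left _ (Ioo_subset_Ioo_left hz.1.le),
          fun h => ?_⟩ hfin
        exact lt_irrefl _ (h ⟨hz, hzZ⟩).1.1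

end SignMatchOn

theorem exists_orderIso_sign_eq {f g : ℝ → ℝ} {Z : Set ℝ} (hfc : Continuous f)
    (hgc : Continuous g) (hZ : Z.Finite)
    (hmono : ∀ a b, Disjoint (Ioo a b) Z →
      StrictMonoOn f (Icc a b) ∧ StrictMonoOn g (Icc a b) ∨
        StrictAntiOn f (Icc a b) ∧ StrictAntiOn g (Icc a b))
    (hsign : ∀ z ∈ Z, sign (f z) = sign (g z))
    (htop : ∀ᶠ x in atTop, sign (f x) = sign (g x))
    (hbot : ∀ᶠ x in atBot, sign (f x) = sign (g x)) :
    ∃ k : ℝ ≃o ℝ, (∀ z ∈ Z, k z = z) ∧ ∀ x, sign (f x) = sign (g (k x)) := by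
  obtain ⟨a, ha⟩ := eventually_atBot.1 hbot
  obtain ⟨b, hb⟩ := eventually_atTop.1 htop
  have hab : min a b ≤ b := min_le_right a b
  obtain ⟨k, hfix, hkZ, hk⟩ := SignMatchOn.of_piecewise_strictMonoOn hfc hgc hZ hmono hsign hab
    (ha _ (min_le_left a b)) (hb b le_rfl)
  refine ⟨k, hkZ, fun x => ?_⟩
  by_cases hx : x ∈ Icc (min a b) b
  · exact hk x hx
  · rw [hfix x fun h => hx (Ioo_subset_Icc_self h)]
    rcases not_and_or.1 hx with hx | hx <;> rw [not_le] at hx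
    · exact ha x (hx.le.trans (min_le_left a b))
    · exact hb x hx.le

theorem eventually_atTop_sign_eval (p : ℝ[X]) :
    ∀ᶠ x in atTop, sign (p.eval x) = sign p.leadingCoeff := by
  obtain ⟨u, hu, hpu⟩ := p.isEquivalent_atTop_lead.exists_eq_mul
  filter_upwards [hpu, hu.eventually_const_lt one_pos, eventually_gt_atTop 0] with x hx hux hx0
  rw [hx, Pi.mul_apply, sign_mul, sign_mul, sign_pos hux, sign_pos (pow_pos hx0 _), one_mul,
    mul_one]

theorem eventually_atBot_sign_eval (p : ℝ[X]) :
    ∀ᶠ x in atBot, sign (p.eval x) = sign ((-1) ^ p.natDegree * p.leadingCoeff) := by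
  filter_upwards [tendsto_neg_atBot_atTop.eventually
    (eventually_atTop_sign_eval (p.comp (-X)))] with x hx
  simpa [comp_neg_X_leadingCoeff_eq] using hx

theorem strictMonoOn_eval_of_derivative_pos {p : ℝ[X]} {a b : ℝ}
    (h : ∀ x ∈ Ioo a b, 0 < p.derivative.eval x) : StrictMonoOn p.eval (Icc a b) :=
  strictMonoOn_of_deriv_pos (convex_Icc a b) p.continuousOn fun x hx => by
    rw [interior_Icc] at hx
    rw [p.deriv]
    exact h x hx

theorem strictAntiOn_eval_of_derivative_neg {p : ℝ[X]} {a b : ℝ}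
    (h : ∀ x ∈ Ioo a b, p.derivative.eval x < 0) : StrictAntiOn p.eval (Icc a b) :=
  strictAntiOn_of_deriv_neg (convex_Icc a b) p.continuousOn fun x hx => by
    rw [interior_Icc] at hx
    rw [p.deriv]
    exact h x hx

theorem strictMonoOn_or_strictAntiOn_eval_comp_orderIso {p q : ℝ[X]} {h : ℝ ≃o ℝ}
    (hder : ∀ x, sign (p.derivative.eval x) = sign (q.derivative.eval (h x))) {a b : ℝ}
    (hab : ∀ x ∈ Ioo a b, p.derivative.eval x ≠ 0) :
    StrictMonoOn p.eval (Icc a b) ∧ StrictMonoOn (fun x => q.eval (h x)) (Icc a b) ∨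
      StrictAntiOn p.eval (Icc a b) ∧ StrictAntiOn (fun x => q.eval (h x)) (Icc a b) := by
  have hconst : ∀ x ∈ Ioo a b, ∀ y ∈ Ioo a b,
      sign (p.derivative.eval x) = sign (p.derivative.eval y) := fun x hx y hy =>
    sign_eq_of_isPreconnected isPreconnected_Ioo p.derivative.continuousOn hab hx hy
  have hder' : ∀ y, sign (p.derivative.eval (h.symm y)) = sign (q.derivative.eval y) := fun y => by
    rw [hder, h.apply_symm_apply]
  have hmaps : MapsTo h (Icc a b) (Icc (h a) (h b)) := h.monotone.mapsTo_Icc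
  have hmaps' : MapsTo h.symm (Ioo (h a) (h b)) (Ioo a b) := fun y hy =>
    ⟨h.lt_symm_apply.2 hy.1, h.symm_apply_lt.2 hy.2⟩
  by_cases hpos : ∀ x ∈ Ioo a b, 0 < p.derivative.eval x
  · exact Or.inl ⟨strictMonoOn_eval_of_derivative_pos hpos,
      (strictMonoOn_eval_of_derivative_pos fun y hy =>
        (pos_iff_pos_of_sign_eq (hder' y)).1 (hpos _ (hmaps' hy))).comp
        (h.strictMono.strictMonoOn _) hmaps⟩
  · push Not at hpos
    obtain ⟨t, ht, hpt⟩ := hpos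
    have hneg : ∀ x ∈ Ioo a b, p.derivative.eval x < 0 := fun x hx =>
      (neg_iff_neg_of_sign_eq (hconst t ht x hx)).1 (hpt.lt_of_ne (hab t ht))
    exact Or.inr ⟨strictAntiOn_eval_of_derivative_neg hneg,
      (strictAntiOn_eval_of_derivative_neg fun y hy =>
        (neg_iff_neg_of_sign_eq (hder' y)).1 (hneg _ (hmaps' hy))).comp_strictMonoOn
        (h.strictMono.strictMonoOn _) hmaps⟩

/-- `h` need only be corrected between consecutive points of `Z`, where both polynomials are
monotone in the same direction. -/
theorem exists_orderIso_sign_eval_eq {p q : ℝ[X]} {h : ℝ ≃o ℝ} {Z : Set ℝ} (hZ : Z.Finite)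
    (hdeg : p.natDegree = q.natDegree) (hlead : sign p.leadingCoeff = sign q.leadingCoeff)
    (hder : ∀ x, sign (p.derivative.eval x) = sign (q.derivative.eval (h x)))
    (hcrit : ∀ x, p.derivative.eval x = 0 → x ∈ Z)
    (hsign : ∀ z ∈ Z, sign (p.eval z) = sign (q.eval (h z))) :
    ∃ k : ℝ ≃o ℝ, (∀ z ∈ Z, k z = z) ∧ ∀ x, sign (p.eval x) = sign (q.eval (h (k x))) := by
  refine exists_orderIso_sign_eq (g := fun x => q.eval (h x)) p.continuous
    (q.continuous.comp h.continuous) hZ (fun a b hab => ?_) hsign ?_ ?_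
  · exact strictMonoOn_or_strictAntiOn_eval_comp_orderIso hder fun x hx h0 =>
      hab.notMem_of_mem_left hx (hcrit x h0)
  · filter_upwards [eventually_atTop_sign_eval p,
      h.tendsto_atTop.eventually (eventually_atTop_sign_eval q)] with x hp hq
    rw [hp, hq, hlead]
  · filter_upwards [eventually_atBot_sign_eval p,
      h.tendsto_atBot.eventually (eventually_atBot_sign_eval q)] with x hp hq
    rw [hp, hq, sign_mul, sign_mul, hlead, hdeg]

/-! ### Finite sets of polynomials closed under pseudo-remainders -/

theorem exists_superset_closed {α : Type*} (deg : α → ℕ) (step : α → α → Finset α)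
    (hstep : ∀ a b, ∀ c ∈ step a b, deg c < deg a ∧ deg c < deg b) (s : Finset α) :
    ∃ t, s ⊆ t ∧ ∀ a ∈ t, ∀ b ∈ t, step a b ⊆ t := by
  classical
  -- Close up pairs of degree at least `N`, for decreasing `N`.
  suffices h : ∀ (N : ℕ) (s : Finset α),
      (∀ a ∈ s, ∀ b ∈ s, N ≤ deg a → N ≤ deg b → step a b ⊆ s) →
      ∃ t, s ⊆ t ∧ ∀ a ∈ t, ∀ b ∈ t, step a b ⊆ t by
    refine h (s.sup deg + 1) s fun a ha _ _ hN => ?_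
    exact absurd (Finset.le_sup ha) (Nat.not_le.2 hN)
  intro N
  induction N with
  | zero =>
    exact fun s hs => ⟨s, subset_rfl, fun a ha b hb =>
      hs a ha b hb (Nat.zero_le _) (Nat.zero_le _)⟩
  | succ N ih =>
    intro s hs
    set new := (s ×ˢ s).biUnion fun p =>
      if N ≤ deg p.1 ∧ N ≤ deg p.2 then step p.1 p.2 else ∅
    have hmem : ∀ a ∈ s ∪ new, N ≤ deg a → a ∈ s := by
      intro c hc hNc
      rcases Finset.mem_union.1 hc with hc | hc
      · exact hc
      obtain ⟨⟨a, b⟩, hab, hc⟩ := Finset.mem_biUnion.1 hc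
      split_ifs at hc with hN
      · refine hs a (Finset.mem_product.1 hab).1 b (Finset.mem_product.1 hab).2 ?_ ?_ hc
        · exact hNc.trans_lt (hstep a b c hc).1
        · exact hNc.trans_lt (hstep a b c hc).2
      · exact absurd hc (Finset.notMem_empty c)
    obtain ⟨t, hst, ht⟩ := ih (s ∪ new) fun a ha b hb hNa hNb c hc =>
      Finset.mem_union_right _ <| Finset.mem_biUnion.2
        ⟨(a, b), Finset.mk_mem_product (hmem a ha hNa) (hmem b hb hNb), by
          rwa [if_pos ⟨hNa, hNb⟩]⟩
    exact ⟨t, Finset.subset_union_left.trans hst, ht⟩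

section PseudoRemainder

variable {A K : Type*} [CommRing A]

theorem exists_pseudoRem (p : A[X]) {q : A[X]} (hq : 0 < q.natDegree) :
    ∃ r : A[X], r.natDegree < q.natDegree ∧ ∃ (k : ℕ) (s : A[X]),
      C (q.leadingCoeff ^ k) * p = s * q + r := by
  induction hn : p.natDegree using Nat.strong_induction_on generalizing p with
  | _ n ih =>
    subst hn
    rcases lt_or_ge p.natDegree q.natDegree with hlt | hle
    · exact ⟨p, hlt, 0, 0, by simp⟩
    obtain ⟨r, hr, k, s, h⟩ :=
      ih _ (natDegree_cancelLeads_lt_of_natDegree_le_natDegree hle (hq.trans_le hle)) _ rfl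
    refine ⟨r, hr, k + 1, s + C (q.leadingCoeff ^ k) *
      (C p.leadingCoeff * X ^ (p.natDegree - q.natDegree)), ?_⟩
    rw [cancelLeads, Nat.sub_eq_zero_of_le hle, pow_zero] at h
    rw [pow_succ, C_mul]
    linear_combination h

/-- A pseudo-remainder of `p` by `q`: up to a multiple of `q`, it is the product of `p` with a power
of the leading coefficient of `q`. It is `0` if `q` is constant. -/
noncomputable def pseudoRem (p q : A[X]) : A[X] :=
  open Classical in if hq : 0 < q.natDegree then (exists_pseudoRem p hq).choose else 0

theorem natDegree_pseudoRem_lt (p : A[X]) {q : A[X]} (hq : 0 < q.natDegree) :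
    (pseudoRem p q).natDegree < q.natDegree := by
  rw [pseudoRem, dif_pos hq]
  exact (exists_pseudoRem p hq).choose_spec.1

theorem exists_C_pow_mul_eq_add_pseudoRem (p : A[X]) {q : A[X]} (hq : 0 < q.natDegree) :
    ∃ (k : ℕ) (s : A[X]), C (q.leadingCoeff ^ k) * p = s * q + pseudoRem p q := by
  rw [pseudoRem, dif_pos hq]
  exact (exists_pseudoRem p hq).choose_spec.2

/-- Closedness under the operations of the Cohen–Hörmander algorithm. -/
def IsRemainderClosed (S : Finset A[X]) : Prop :=
  ∀ p ∈ S, ∀ q ∈ S, 0 < q.natDegree → q.natDegree ≤ p.natDegree →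
    pseudoRem p q ∈ S ∧ q.eraseLead ∈ S ∧ derivative q ∈ S

theorem natDegree_eraseLead_lt {p : A[X]} (hp : 0 < p.natDegree) :
    p.eraseLead.natDegree < p.natDegree :=
  (eraseLead_natDegree_le p).trans_lt (Nat.sub_lt hp one_pos)

theorem exists_superset_isRemainderClosed (s : Finset A[X]) :
    ∃ S, s ⊆ S ∧ IsRemainderClosed S := by
  classical
  let step (p q : A[X]) : Finset A[X] :=
    if 0 < q.natDegree ∧ q.natDegree ≤ p.natDegree then
      {pseudoRem p q, q.eraseLead, derivative q} else ∅
  have hstep : ∀ p q, ∀ r ∈ step p q, r.natDegree < p.natDegree ∧ r.natDegree < q.natDegree := by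
    intro p q r hr
    dsimp only [step] at hr
    split_ifs at hr with h
    · suffices hlt : r.natDegree < q.natDegree from ⟨hlt.trans_le h.2, hlt⟩
      simp only [Finset.mem_insert, Finset.mem_singleton] at hr
      rcases hr with rfl | rfl | rfl
      · exact natDegree_pseudoRem_lt p h.1
      · exact natDegree_eraseLead_lt h.1
      · exact natDegree_derivative_lt h.1.ne'
    · exact absurd hr (Finset.notMem_empty r)
  obtain ⟨S, hsS, hS⟩ := exists_superset_closed natDegree step hstep s
  refine ⟨S, hsS, fun p hp q hq h0 hle => ?_⟩
  have := hS p hp q hq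
  rw [show step p q = _ from if_pos ⟨h0, hle⟩] at this
  simpa only [Finset.insert_subset_iff, Finset.singleton_subset_iff] using this

theorem mem_of_mem_insert_of_natDegree_lt [DecidableEq A[X]] {s : Finset A[X]} {p q : A[X]}
    (hq : q ∈ insert p s) (hlt : q.natDegree < p.natDegree) : q ∈ s :=
  Finset.mem_of_mem_insert_of_ne hq (by rintro rfl; exact hlt.false)

theorem IsRemainderClosed.of_insert [DecidableEq A[X]] {s : Finset A[X]} {p : A[X]}
    (h : IsRemainderClosed (insert p s)) (hmax : ∀ q ∈ s, q.natDegree ≤ p.natDegree) :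
    IsRemainderClosed s := by
  intro f hf q hq h0 hle
  have hmem : ∀ r ∈ insert p s, r.natDegree < q.natDegree → r ∈ s := fun r hr hlt =>
    mem_of_mem_insert_of_natDegree_lt hr (hlt.trans_le (hmax q hq))
  obtain ⟨h₁, h₂, h₃⟩ := h f (Finset.mem_insert_of_mem hf) q (Finset.mem_insert_of_mem hq) h0 hle
  exact ⟨hmem _ h₁ (natDegree_pseudoRem_lt f h0), hmem _ h₂ (natDegree_eraseLead_lt h0),
    hmem _ h₃ (natDegree_derivative_lt h0.ne')⟩

theorem map_eraseLead_of_map_leadingCoeff_eq_zero [Semiring K] {φ : A →+* K} {p : A[X]}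
    (h : φ p.leadingCoeff = 0) : p.eraseLead.map φ = p.map φ := by
  conv_rhs => rw [← eraseLead_add_C_mul_X_pow p]
  rw [Polynomial.map_add, Polynomial.map_mul, map_C, h, C_0, zero_mul, add_zero]

theorem exists_pow_mul_eval_map_eq [CommRing K] (p : A[X]) {q : A[X]} (hq : 0 < q.natDegree) :
    ∃ k : ℕ, ∀ (φ : A →+* K) (z : K), (q.map φ).IsRoot z →
      φ q.leadingCoeff ^ k * (p.map φ).eval z = ((pseudoRem p q).map φ).eval z := by
  obtain ⟨k, s, h⟩ := exists_C_pow_mul_eq_add_pseudoRem p hq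
  refine ⟨k, fun φ z hz => ?_⟩
  have := congrArg (fun f => (f.map φ).eval z) h
  simpa [hz.eq_zero] using this

variable [CommRing K] {φ ψ : A →+* K} {S : Finset A[X]}

theorem natDegree_pos_of_isRoot_map {q : A[X]} {z : K} (h0 : q.map φ ≠ 0)
    (hz : (q.map φ).IsRoot z) : 0 < q.natDegree :=
  (natDegree_pos_iff_degree_pos.2 (degree_pos_of_root h0 hz)).trans_le natDegree_map_le

namespace IsRemainderClosed

theorem map_eq_zero_of_map_eq_zero (hS : IsRemainderClosed S)
    (h : ∀ q ∈ S, φ q.leadingCoeff = 0 → ψ q.leadingCoeff = 0) {q : A[X]} (hq : q ∈ S)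
    (hφ : q.map φ = 0) : q.map ψ = 0 := by
  induction hn : q.natDegree using Nat.strong_induction_on generalizing q with
  | _ n ih =>
    subst hn
    have hφq : φ q.leadingCoeff = 0 := by
      rw [leadingCoeff, ← coeff_map, hφ, coeff_zero]
    have hψq := h q hq hφq
    rcases q.natDegree.eq_zero_or_pos with h0 | h0
    · rw [eq_C_of_natDegree_eq_zero h0, ← h0, map_C, C_eq_zero]
      exact hψq
    · rw [← map_eraseLead_of_map_leadingCoeff_eq_zero hφq] at hφ
      rw [← map_eraseLead_of_map_leadingCoeff_eq_zero hψq]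
      exact ih _ (natDegree_eraseLead_lt h0) (hS q hq q hq h0 le_rfl).2.1 hφ rfl

theorem exists_minimal_isRoot (hS : IsRemainderClosed S) {p : A[X]} (hp : p ∈ S)
    (h0 : p.map φ ≠ 0) {z : K} (hz : (p.map φ).IsRoot z) :
    ∃ d ∈ S, φ d.leadingCoeff ≠ 0 ∧ (d.map φ).IsRoot z ∧ 0 < d.natDegree ∧
      ∀ q ∈ S, (q.map φ).IsRoot z → q.natDegree < d.natDegree → q.map φ = 0 := by
  classical
  obtain ⟨d, hd, hmin⟩ := (S.filter fun q => q.map φ ≠ 0 ∧ (q.map φ).IsRoot z).exists_min_image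
    natDegree ⟨p, Finset.mem_filter.2 ⟨hp, h0, hz⟩⟩
  obtain ⟨hdS, hd0, hdz⟩ := Finset.mem_filter.1 hd
  have hpos := natDegree_pos_of_isRoot_map hd0 hdz
  have hmin' : ∀ q ∈ S, (q.map φ).IsRoot z → q.natDegree < d.natDegree → q.map φ = 0 :=
    fun q hq hqz hlt => by_contra fun hq0 =>
      (hmin q (Finset.mem_filter.2 ⟨hq, hq0, hqz⟩)).not_gt hlt
  refine ⟨d, hdS, fun hlead => hd0 ?_, hdz, hpos, hmin'⟩
  have herase := map_eraseLead_of_map_leadingCoeff_eq_zero hlead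
  rw [← herase]
  exact hmin' _ (hS d hdS d hdS hpos le_rfl).2.1 (by rwa [herase]) (natDegree_eraseLead_lt hpos)

theorem isRoot_map_of_isRoot_map [NoZeroDivisors K] (hS : IsRemainderClosed S)
    (hzero : ∀ q ∈ S, q.map φ = 0 → q.map ψ = 0) {d : A[X]} (hd : d ∈ S) (hd0 : 0 < d.natDegree)
    (hlead : ψ d.leadingCoeff ≠ 0) {y z : K} (hy : (d.map φ).IsRoot y) (hz : (d.map ψ).IsRoot z)
    (hmin : ∀ q ∈ S, (q.map φ).IsRoot y → q.natDegree < d.natDegree → q.map φ = 0)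
    {q : A[X]} (hq : q ∈ S) (hqy : (q.map φ).IsRoot y) : (q.map ψ).IsRoot z := by
  rcases lt_or_ge q.natDegree d.natDegree with hlt | hle
  · rw [hzero q hq (hmin q hq hqy hlt)]
    exact eval_zero
  have hr := (hS q hq d hd hd0 hle).1
  obtain ⟨k, hk⟩ := exists_pow_mul_eval_map_eq (K := K) q hd0
  have hry : ((pseudoRem q d).map φ).IsRoot y := by
    rw [IsRoot, ← hk φ y hy, hqy.eq_zero, mul_zero]
  have hkz := hk ψ z hz
  rw [hzero _ hr (hmin _ hr hry (natDegree_pseudoRem_lt q hd0)), eval_zero] at hkz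
  exact (mul_eq_zero.1 hkz).resolve_left (pow_ne_zero k hlead)

end IsRemainderClosed

end PseudoRemainder

/-! ### Sign patterns of polynomials over the reals -/

section RealSigns

variable {A : Type*} [CommRing A] {φ ψ : A →+* ℝ} {s : Finset A[X]}

/-- The change of variables `h` carries the signs of the polynomials in `s`, with coefficients
mapped by `φ`, to those of the same polynomials with coefficients mapped by `ψ`. -/
def MatchesSigns (s : Finset A[X]) (φ ψ : A →+* ℝ) (h : ℝ ≃o ℝ) : Prop :=
  ∀ p ∈ s, ∀ x, sign ((p.map φ).eval x) = sign ((p.map ψ).eval (h x))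

/-- The real roots of those polynomials of `s` that `φ` does not annihilate. -/
def rootUnion (s : Finset A[X]) (φ : A →+* ℝ) : Set ℝ :=
  ⋃ q ∈ s, {z | q.map φ ≠ 0 ∧ (q.map φ).IsRoot z}

theorem finite_rootUnion (s : Finset A[X]) (φ : A →+* ℝ) : (rootUnion s φ).Finite := by
  refine s.finite_toSet.biUnion fun q _ => ?_
  by_cases hq : q.map φ = 0
  · simp only [hq, ne_eq, not_true_eq_false, false_and, ofPred_false, finite_empty]
  · exact (finite_setOfPred_isRoot hq).subset fun z hz => hz.2

theorem MatchesSigns.trans {h k : ℝ ≃o ℝ} (hs : MatchesSigns s φ ψ h)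
    (hk : ∀ z ∈ rootUnion s φ, k z = z) :
    MatchesSigns s φ ψ (k.trans h) := by
  intro q hq x
  rw [OrderIso.trans_apply, ← hs q hq]
  by_cases h0 : q.map φ = 0
  · rw [h0, eval_zero, eval_zero]
  · exact (sign_apply_orderIso (q.map φ).continuous
      (fun z hz => hk z (mem_biUnion hq ⟨h0, hz⟩)) x).symm

theorem MatchesSigns.sign_eval_eq_of_isRoot {h : ℝ ≃o ℝ} (hs : MatchesSigns s φ ψ h)
    {p d : A[X]} (hd : d ∈ s) (hd0 : 0 < d.natDegree) (hr : pseudoRem p d ∈ s)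
    (hlead : φ d.leadingCoeff ≠ 0) (hsign : sign (φ d.leadingCoeff) = sign (ψ d.leadingCoeff))
    {z : ℝ} (hz : (d.map φ).IsRoot z) :
    sign ((p.map φ).eval z) = sign ((p.map ψ).eval (h z)) := by
  have hz' : (d.map ψ).IsRoot (h z) := by
    rw [IsRoot, ← sign_eq_zero_iff, ← hs d hd, hz.eq_zero, sign_zero]
  obtain ⟨k, hk⟩ := exists_pow_mul_eval_map_eq (K := ℝ) p hd0
  have hφ := congrArg sign (hk φ z hz)
  have hψ := congrArg sign (hk ψ (h z) hz')
  rw [hs _ hr, ← hψ, sign_mul, sign_mul, sign_pow, sign_pow, ← hsign] at hφ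
  exact mul_left_cancel₀ (pow_ne_zero _ (sign_ne_zero.2 hlead)) hφ

theorem exists_orderIso_fix_rootUnion [DecidableEq A[X]] {p : A[X]}
    (hS : IsRemainderClosed (insert p s)) (hmax : ∀ q ∈ s, q.natDegree ≤ p.natDegree)
    (hlead : ∀ q ∈ insert p s, sign (φ q.leadingCoeff) = sign (ψ q.leadingCoeff))
    {h : ℝ ≃o ℝ} (hs : MatchesSigns s φ ψ h) (h0 : 0 < p.natDegree)
    (hφp : φ p.leadingCoeff ≠ 0) :
    ∃ k : ℝ ≃o ℝ, (∀ z ∈ rootUnion s φ, k z = z) ∧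
      ∀ x, sign ((p.map φ).eval x) = sign ((p.map ψ).eval (h (k x))) := by
  have hpS := Finset.mem_insert_self p s
  have hψp : ψ p.leadingCoeff ≠ 0 := by rwa [← sign_ne_zero, ← hlead p hpS, sign_ne_zero]
  have hdegφ := natDegree_map_of_leadingCoeff_ne_zero φ hφp
  have hdegψ := natDegree_map_of_leadingCoeff_ne_zero ψ hψp
  have hderiv := mem_of_mem_insert_of_natDegree_lt (hS p hpS p hpS h0 le_rfl).2.2
    (natDegree_derivative_lt h0.ne')
  refine exists_orderIso_sign_eval_eq (finite_rootUnion s φ) (hdegφ.trans hdegψ.symm) ?_ ?_ ?_ ?_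
  · rw [leadingCoeff_map_of_leadingCoeff_ne_zero φ hφp,
      leadingCoeff_map_of_leadingCoeff_ne_zero ψ hψp]
    exact hlead p hpS
  · intro x
    rw [derivative_map, derivative_map]
    exact hs _ hderiv x
  · intro x hx
    rw [derivative_map] at hx
    refine mem_biUnion hderiv ⟨fun hzero => h0.ne' ?_, hx⟩
    rw [← derivative_map] at hzero
    exact hdegφ.symm.trans (derivative_eq_zero.1 hzero)
  · intro z hz
    obtain ⟨q, hq, hq0, hqz⟩ := mem_iUnion₂.1 hz
    obtain ⟨d, hd, hdlead, hdz, hdpos, -⟩ :=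
      (hS.of_insert hmax).exists_minimal_isRoot hq hq0 hqz
    have hdS := Finset.mem_insert_of_mem (b := p) hd
    have hr := mem_of_mem_insert_of_natDegree_lt (hS p hpS d hdS hdpos (hmax d hd)).1
      ((natDegree_pseudoRem_lt p hdpos).trans_le (hmax d hd))
    exact hs.sign_eval_eq_of_isRoot hd hdpos hr hdlead (hlead d hdS) hdz

theorem exists_matchesSigns_insert [DecidableEq A[X]] {p : A[X]}
    (hS : IsRemainderClosed (insert p s)) (hmax : ∀ q ∈ s, q.natDegree ≤ p.natDegree)
    (hlead : ∀ q ∈ insert p s, sign (φ q.leadingCoeff) = sign (ψ q.leadingCoeff))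
    {h : ℝ ≃o ℝ} (hs : MatchesSigns s φ ψ h) : ∃ h', MatchesSigns (insert p s) φ ψ h' := by
  have hpS := Finset.mem_insert_self p s
  have hpsign := hlead p hpS
  rcases p.natDegree.eq_zero_or_pos with h0 | h0
  · refine ⟨h, Finset.forall_mem_insert _ _ _ |>.2 ⟨fun x => ?_, hs⟩⟩
    rw [eq_C_of_natDegree_eq_zero h0, map_C, map_C, eval_C, eval_C, ← h0]
    exact hpsign
  by_cases hφp : φ p.leadingCoeff = 0
  · have hψp : ψ p.leadingCoeff = 0 := by rw [← sign_eq_zero_iff, ← hpsign, hφp, sign_zero]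
    refine ⟨h, Finset.forall_mem_insert _ _ _ |>.2 ⟨fun x => ?_, hs⟩⟩
    rw [← map_eraseLead_of_map_leadingCoeff_eq_zero hφp,
      ← map_eraseLead_of_map_leadingCoeff_eq_zero hψp]
    exact hs _ (mem_of_mem_insert_of_natDegree_lt (hS p hpS p hpS h0 le_rfl).2.1
      (natDegree_eraseLead_lt h0)) x
  · obtain ⟨k, hk, hp⟩ := exists_orderIso_fix_rootUnion hS hmax hlead hs h0 hφp
    exact ⟨k.trans h, Finset.forall_mem_insert _ _ _ |>.2 ⟨hp, hs.trans hk⟩⟩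

theorem IsRemainderClosed.exists_matchesSigns (hs : IsRemainderClosed s)
    (hlead : ∀ q ∈ s, sign (φ q.leadingCoeff) = sign (ψ q.leadingCoeff)) :
    ∃ h, MatchesSigns s φ ψ h := by
  classical
  induction s using Finset.induction_on_max_value (natDegree (R := A)) with
  | empty => exact ⟨OrderIso.refl ℝ, fun p hp => absurd hp (Finset.notMem_empty p)⟩
  | insert p s _ hmax ih =>
    obtain ⟨h, hh⟩ := ih (hs.of_insert hmax) fun q hq => hlead q (Finset.mem_insert_of_mem hq)
    exact exists_matchesSigns_insert hs hmax hlead hh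

theorem exists_finset_forall_sign_eval_eq (s : Finset A[X]) :
    ∃ T : Finset A, ∀ φ ψ : A →+* ℝ, (∀ t ∈ T, sign (φ t) = sign (ψ t)) →
      ∀ y, ∃ z, ∀ p ∈ s, sign ((p.map φ).eval y) = sign ((p.map ψ).eval z) := by
  classical
  obtain ⟨S, hsS, hS⟩ := exists_superset_isRemainderClosed s
  refine ⟨S.image leadingCoeff, fun φ ψ hT y => ?_⟩
  obtain ⟨h, hh⟩ := hS.exists_matchesSigns fun q hq => hT _ (Finset.mem_image_of_mem _ hq)
  exact ⟨h y, fun p hp => hh p (hsS hp) y⟩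

end RealSigns

/-! ### Zero patterns of polynomials over algebraically closed fields -/

section ZeroPatterns

theorem exists_forall_not_isRoot {R : Type*} [CommRing R] [IsDomain R] [Infinite R]
    {G : Finset R[X]} (hG : ∀ g ∈ G, g ≠ 0) :
    ∃ z, ∀ g ∈ G, ¬ g.IsRoot z := by
  by_contra! h
  refine Finset.prod_ne_zero_iff.2 hG (Polynomial.funext fun z => ?_)
  obtain ⟨g, hg, hgz⟩ := h z
  rw [eval_zero, eval_prod]
  exact Finset.prod_eq_zero hg hgz

variable {A K : Type*} [CommRing A]

/-- Test elements detecting the zero patterns of the polynomials in `S`: vanishing of the leading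
coefficients decides vanishing of the polynomials, and for `G ⊆ S` and `d ∈ S`, the pseudo-remainder
decides whether some root of `d` avoids the roots of all members of `G`. -/
noncomputable def zeroTests (S : Finset A[X]) : Finset A :=
  open Classical in S.image leadingCoeff ∪ (S.powerset ×ˢ S).biUnion fun x =>
    (pseudoRem ((∏ g ∈ x.1, g) ^ x.2.natDegree) x.2).coeffs

variable {S : Finset A[X]}

theorem map_leadingCoeff_eq_zero_iff [Semiring K] {φ ψ : A →+* K}
    (hT : ∀ t ∈ zeroTests S, φ t = 0 ↔ ψ t = 0) {q : A[X]} (hq : q ∈ S) :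
    φ q.leadingCoeff = 0 ↔ ψ q.leadingCoeff = 0 := by
  classical
  exact hT _ (Finset.mem_union_left _ (Finset.mem_image_of_mem _ hq))

theorem map_pseudoRem_ne_zero [Semiring K] {φ ψ : A →+* K}
    (hT : ∀ t ∈ zeroTests S, φ t = 0 ↔ ψ t = 0) {G : Finset A[X]} (hG : G ⊆ S) {d : A[X]}
    (hd : d ∈ S)
    (h : (pseudoRem ((∏ g ∈ G, g) ^ d.natDegree) d).map φ ≠ 0) :
    (pseudoRem ((∏ g ∈ G, g) ^ d.natDegree) d).map ψ ≠ 0 := by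
  classical
  refine fun h0 => h (Polynomial.ext fun n => ?_)
  have hn := congrArg (coeff · n) h0
  simp only [coeff_map, coeff_zero] at hn ⊢
  by_cases hc : (pseudoRem ((∏ g ∈ G, g) ^ d.natDegree) d).coeff n = 0
  · rw [hc, map_zero]
  · exact (hT _ (Finset.mem_union_right _ (Finset.mem_biUnion.2
      ⟨(G, d), Finset.mk_mem_product (Finset.mem_powerset.2 hG) hd, coeff_mem_coeffs hc⟩))).2 hn

variable [Field K] [IsAlgClosed K] {φ ψ : A →+* K}

theorem dvd_pow_natDegree_of_forall_isRoot {f g : K[X]} (hf : f ≠ 0)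
    (h : ∀ z, f.IsRoot z → g.IsRoot z) : f ∣ g ^ f.natDegree := by
  have hsplit := IsAlgClosed.splits f
  have hprod : (f.roots.map (X - C ·)).prod ∣ (f.roots.map fun _ => g).prod :=
    Multiset.prod_dvd_prod_of_dvd _ _ fun z hz => dvd_iff_isRoot.2 (h z (isRoot_of_mem_roots hz))
  rw [Multiset.map_const', Multiset.prod_replicate, ← hsplit.natDegree_eq_card_roots] at hprod
  conv_lhs => rw [hsplit.eq_prod_roots]
  exact (isUnit_C.2 (leadingCoeff_ne_zero.2 hf).isUnit).mul_left_dvd.2 hprod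

theorem exists_isRoot_not_isRoot {g d : A[X]} (hd : 0 < d.natDegree)
    (hlead : ψ d.leadingCoeff ≠ 0) (hr : (pseudoRem (g ^ d.natDegree) d).map ψ ≠ 0) :
    ∃ z, (d.map ψ).IsRoot z ∧ ¬ (g.map ψ).IsRoot z := by
  by_contra! hroots
  have hdeg := natDegree_map_of_leadingCoeff_ne_zero ψ hlead
  have hd0 : d.map ψ ≠ 0 := ne_zero_of_natDegree_gt (hd.trans_eq hdeg.symm)
  obtain ⟨k, s, h⟩ := exists_C_pow_mul_eq_add_pseudoRem (g ^ d.natDegree) hd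
  have hmap : C (ψ d.leadingCoeff ^ k) * g.map ψ ^ d.natDegree =
      s.map ψ * d.map ψ + (pseudoRem (g ^ d.natDegree) d).map ψ := by
    simpa only [Polynomial.map_mul, Polynomial.map_add, Polynomial.map_pow, map_C, map_pow]
      using congrArg (Polynomial.map ψ) h
  have hdvd : d.map ψ ∣ g.map ψ ^ d.natDegree :=
    hdeg ▸ dvd_pow_natDegree_of_forall_isRoot hd0 hroots
  have hdvd_rem : d.map ψ ∣ (pseudoRem (g ^ d.natDegree) d).map ψ := by
    rw [← dvd_add_right (dvd_mul_left _ (s.map ψ)), ← hmap]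
    exact hdvd.mul_left _
  refine hr (eq_zero_of_dvd_of_natDegree_lt hdvd_rem ?_)
  rw [hdeg]
  exact natDegree_map_le.trans_lt (natDegree_pseudoRem_lt _ hd)

theorem exists_isRoot_forall_not_isRoot (hT : ∀ t ∈ zeroTests S, φ t = 0 ↔ ψ t = 0)
    {G : Finset A[X]} (hG : G ⊆ S) {d : A[X]} (hd : d ∈ S) (hd0 : 0 < d.natDegree)
    (hlead : φ d.leadingCoeff ≠ 0) {y : K} (hdy : (d.map φ).IsRoot y)
    (hGy : ∀ g ∈ G, ¬ (g.map φ).IsRoot y) :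
    ∃ z, (d.map ψ).IsRoot z ∧ ∀ g ∈ G, ¬ (g.map ψ).IsRoot z := by
  obtain ⟨k, hk⟩ := exists_pow_mul_eval_map_eq (K := K) ((∏ g ∈ G, g) ^ d.natDegree) hd0
  have hrem : (pseudoRem ((∏ g ∈ G, g) ^ d.natDegree) d).map φ ≠ 0 := by
    intro h0
    have hky := hk φ y hdy
    rw [h0, eval_zero, Polynomial.map_pow, eval_pow, Polynomial.map_prod, eval_prod] at hky
    exact mul_ne_zero (pow_ne_zero _ hlead) (pow_ne_zero _ (Finset.prod_ne_zero_iff.2 hGy)) hky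
  obtain ⟨z, hz, hGz⟩ := exists_isRoot_not_isRoot hd0
    (mt (map_leadingCoeff_eq_zero_iff hT hd).2 hlead) (map_pseudoRem_ne_zero hT hG hd hrem)
  rw [IsRoot, Polynomial.map_prod, eval_prod] at hGz
  exact ⟨z, hz, Finset.prod_ne_zero_iff.1 hGz⟩

theorem IsRemainderClosed.exists_forall_isRoot_iff (hS : IsRemainderClosed S)
    (hT : ∀ t ∈ zeroTests S, φ t = 0 ↔ ψ t = 0) (y : K) :
    ∃ z, ∀ q ∈ S, (q.map φ).IsRoot y ↔ (q.map ψ).IsRoot z := by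
  classical
  have hzero : ∀ q ∈ S, q.map φ = 0 ↔ q.map ψ = 0 := fun q hq =>
    ⟨hS.map_eq_zero_of_map_eq_zero (fun q hq => (map_leadingCoeff_eq_zero_iff hT hq).1) hq,
      hS.map_eq_zero_of_map_eq_zero (fun q hq => (map_leadingCoeff_eq_zero_iff hT hq).2) hq⟩
  set G := S.filter fun q => ¬ (q.map φ).IsRoot y
  suffices h : ∃ z, (∀ q ∈ S, (q.map φ).IsRoot y → (q.map ψ).IsRoot z) ∧
      ∀ g ∈ G, ¬ (g.map ψ).IsRoot z by
    obtain ⟨z, hz, hGz⟩ := h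
    exact ⟨z, fun q hq => ⟨hz q hq, fun hqz => by_contra fun hqy =>
      hGz q (Finset.mem_filter.2 ⟨hq, hqy⟩) hqz⟩⟩
  by_cases hex : ∃ p ∈ S, p.map φ ≠ 0 ∧ (p.map φ).IsRoot y
  · obtain ⟨p, hp, hp0, hpy⟩ := hex
    obtain ⟨d, hd, hlead, hdy, hd0, hmin⟩ := hS.exists_minimal_isRoot hp hp0 hpy
    obtain ⟨z, hdz, hGz⟩ := exists_isRoot_forall_not_isRoot hT (Finset.filter_subset _ S) hd hd0
      hlead hdy fun g hg => (Finset.mem_filter.1 hg).2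
    have hlead' := mt (map_leadingCoeff_eq_zero_iff hT hd).2 hlead
    exact ⟨z, fun q => hS.isRoot_map_of_isRoot_map (fun q hq => (hzero q hq).1) hd hd0 hlead'
      hdy hdz hmin, hGz⟩
  · push Not at hex
    obtain ⟨z, hz⟩ := exists_forall_not_isRoot (G := G.image (Polynomial.map ψ)) <|
      Finset.forall_mem_image.2 fun g hg h0 => by
        obtain ⟨hgS, hgy⟩ := Finset.mem_filter.1 hg
        rw [(hzero g hgS).2 h0] at hgy
        exact hgy eval_zero
    refine ⟨z, fun q hq hqy => ?_, fun g hg => hz _ (Finset.mem_image_of_mem _ hg)⟩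
    rw [(hzero q hq).1 (by_contra fun h0 => hex q hq h0 hqy)]
    exact eval_zero

theorem exists_finset_forall_isRoot_iff (s : Finset A[X]) :
    ∃ T : Finset A, ∀ φ ψ : A →+* K, (∀ t ∈ T, φ t = 0 ↔ ψ t = 0) →
      ∀ y, ∃ z, ∀ p ∈ s, (p.map φ).IsRoot y ↔ (p.map ψ).IsRoot z := by
  obtain ⟨S, hsS, hS⟩ := exists_superset_isRemainderClosed s
  refine ⟨zeroTests S, fun φ ψ hT y => ?_⟩
  obtain ⟨z, hz⟩ := hS.exists_forall_isRoot_iff hT y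
  exact ⟨z, fun p hp => hz p (hsS hp)⟩

end ZeroPatterns

/-! ### Sets defined by quantifier-free formulas -/

section QFDefinable

open FirstOrder.Language

variable (L : FirstOrder.Language) {M : Type*} [L.Structure M] {α β : Type*}

/-- The sets of tuples defined by a quantifier-free formula without parameters. -/
def QFDefinable (s : Set (α → M)) : Prop :=
  ∃ ψ : L.Formula α, ψ.IsQF ∧ ∀ x, x ∈ s ↔ ψ.Realize x

theorem isQF_subst {L : FirstOrder.Language} {n : ℕ} {φ : L.BoundedFormula α n}
    (h : φ.IsQF) (f : α → L.Term β) : (φ.subst f).IsQF := by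
  induction h with
  | falsum => exact .falsum
  | of_isAtomic h =>
    cases h with
    | equal t₁ t₂ => exact (BoundedFormula.IsAtomic.equal _ _).isQF
    | rel R ts => exact (BoundedFormula.IsAtomic.rel _ _).isQF
  | imp _ _ h₁ h₂ => exact h₁.imp h₂

namespace QFDefinable

variable {L} {s t : Set (α → M)}

theorem term_eq (t₁ t₂ : L.Term α) : QFDefinable L {x : α → M | t₁.realize x = t₂.realize x} :=
  ⟨t₁.equal t₂, (BoundedFormula.IsAtomic.equal _ _).isQF, fun x => by
    rw [Formula.realize_equal, mem_ofPred_eq]⟩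

theorem rel {n : ℕ} (R : L.Relations n) (ts : Fin n → L.Term α) :
    QFDefinable L {x : α → M | Structure.RelMap R fun i => (ts i).realize x} :=
  ⟨R.formula ts, (BoundedFormula.IsAtomic.rel _ _).isQF, fun x => by
    rw [Formula.realize_rel, mem_ofPred_eq]⟩

theorem empty : QFDefinable L (∅ : Set (α → M)) :=
  ⟨⊥, BoundedFormula.isQF_bot, fun x => by simp⟩

theorem compl (hs : QFDefinable L s) : QFDefinable L sᶜ := by
  obtain ⟨ψ, hψ, h⟩ := hs
  exact ⟨ψ.not, hψ.not, fun x => by rw [mem_compl_iff, h, Formula.realize_not]⟩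

theorem inter (hs : QFDefinable L s) (ht : QFDefinable L t) : QFDefinable L (s ∩ t) := by
  obtain ⟨ψ, hψ, h⟩ := hs
  obtain ⟨ψ', hψ', h'⟩ := ht
  exact ⟨ψ ⊓ ψ', hψ.inf hψ', fun x => by rw [mem_inter_iff, h, h', Formula.realize_inf]⟩

theorem union (hs : QFDefinable L s) (ht : QFDefinable L t) : QFDefinable L (s ∪ t) := by
  rw [← compl_compl (s ∪ t), compl_union]
  exact (hs.compl.inter ht.compl).compl

theorem iUnion_of_finite {ι : Type*} [Finite ι] {s : ι → Set (α → M)}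
    (hs : ∀ i, QFDefinable L (s i)) : QFDefinable L (⋃ i, s i) := by
  induction ι using Finite.induction_empty_option with
  | of_equiv e ih =>
    rw [← e.surjective.iUnion_comp]
    exact ih fun i => hs (e i)
  | h_empty =>
    rw [iUnion_of_empty]
    exact empty
  | h_option ih =>
    rw [iUnion_option]
    exact (hs none).union (ih fun i => hs (some i))

theorem iInter_of_finite {ι : Type*} [Finite ι] {s : ι → Set (α → M)}
    (hs : ∀ i, QFDefinable L (s i)) : QFDefinable L (⋂ i, s i) := by
  rw [← compl_compl (⋂ i, s i), compl_iInter]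
  exact (iUnion_of_finite fun i => (hs i).compl).compl

theorem preimage_realize (hs : QFDefinable L s) (f : α → L.Term β) :
    QFDefinable L {y : β → M | (fun a => (f a).realize y) ∈ s} := by
  obtain ⟨ψ, hψ, h⟩ := hs
  refine ⟨ψ.subst f, isQF_subst hψ f, fun y => ?_⟩
  rw [mem_ofPred_eq, h, Formula.Realize, Formula.Realize, BoundedFormula.realize_subst]

theorem preimage_comp (hs : QFDefinable L s) (f : α → β) :
    QFDefinable L {y : β → M | y ∘ f ∈ s} :=
  hs.preimage_realize fun a => Term.var (f a)

end QFDefinable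

/-- Over `M`, existential quantifiers can be eliminated one at a time. The quantified variable is
`none`. -/
def EliminatesExists (M : Type*) [L.Structure M] : Prop :=
  ∀ (α : Type) (s : Set (Option α → M)), QFDefinable L s →
    QFDefinable L {x : α → M | ∃ a, (fun o => o.elim a x) ∈ s}

variable {L}

theorem EliminatesExists.qfDefinable_realize (h : EliminatesExists L M) {α : Type} {n : ℕ}
    (φ : L.BoundedFormula α n) :
    QFDefinable L {x : α ⊕ Fin n → M | φ.Realize (x ∘ Sum.inl) (x ∘ Sum.inr)} := by
  induction φ with
  | falsum => exact .empty
  | equal t₁ t₂ =>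
    simp only [BoundedFormula.Realize, Sum.elim_comp_inl_inr]
    exact .term_eq t₁ t₂
  | rel R ts =>
    simp only [BoundedFormula.Realize, Sum.elim_comp_inl_inr]
    exact .rel R ts
  | imp φ₁ φ₂ ih₁ ih₂ =>
    simp only [BoundedFormula.realize_imp, imp_iff_not_or]
    exact ih₁.compl.union ih₂
  | @all n φ ih =>
    let e : α ⊕ Fin (n + 1) → Option (α ⊕ Fin n) :=
      Sum.elim (some ∘ Sum.inl) (Fin.snoc (α := fun _ => Option (α ⊕ Fin n)) (some ∘ Sum.inr) none)
    convert (h _ _ (ih.compl.preimage_comp e)).compl using 1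
    ext x
    have hsnoc : ∀ a : M, ((fun o : Option (α ⊕ Fin n) => o.elim a x) ∘ e) ∘ Sum.inr =
        Fin.snoc (α := fun _ => M) (x ∘ Sum.inr) a := fun a => by
      rw [Function.comp_assoc, Sum.elim_comp_inr, Fin.comp_snoc]
      rfl
    simp only [mem_ofPred_eq, mem_compl_iff, not_exists, not_not, hsnoc,
      BoundedFormula.realize_all]
    rfl

theorem EliminatesExists.hasQE (h : EliminatesExists L M) :
    HasQE (inferInstance : L.Structure M) := by
  intro k φ
  obtain ⟨ψ, hψ, hφψ⟩ :=
    (h.qfDefinable_realize φ).preimage_comp (Sum.elim id (Fin.elim0 (α := Fin k)))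
  refine ⟨ψ, hψ, fun x => ?_⟩
  rw [← hφψ x, mem_ofPred_eq, mem_ofPred_eq, Formula.Realize]
  exact iff_of_eq (congrArg₂ _ rfl (Subsingleton.elim _ _))

end QFDefinable

/-! ### Relational expansions of commutative rings -/

theorem eval_map_optionEquivLeft {α R K : Type*} [CommRing R] [CommRing K] [Algebra R K]
    (x : α → K) (a : K) (P : MvPolynomial (Option α) R) :
    ((MvPolynomial.optionEquivLeft R α P).map
        (MvPolynomial.aeval x : MvPolynomial α R →ₐ[R] K).toRingHom).eval a =
      MvPolynomial.aeval (fun o : Option α => o.elim a x) P := by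
  induction P using MvPolynomial.induction_on with
  | C r => simp
  | add P Q hP hQ => simp only [map_add, Polynomial.map_add, eval_add, hP, hQ]
  | mul_X P i hP =>
    rw [map_mul, map_mul, Polynomial.map_mul, eval_mul, hP, MvPolynomial.aeval_X]
    cases i <;> simp

section ColorDetermined

variable {σ K : Type*} [CommRing K] {α : Type} {c : K → σ} {s t : Set (α → K)}

/-- Whether a tuple belongs to `s` depends only on the colors that `c` assigns to the values of
finitely many integer polynomials at this tuple. -/
def ColorDetermined (c : K → σ) (s : Set (α → K)) : Prop :=
  ∃ T : Finset (MvPolynomial α ℤ), ∀ x y,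
    (∀ P ∈ T, c (MvPolynomial.aeval x P) = c (MvPolynomial.aeval y P)) → (x ∈ s ↔ y ∈ s)

/-- The colors that finitely many polynomials in one variable can take simultaneously depend only
on the colors of finitely many elements of the ring of coefficients. -/
def HasColorPatterns (c : K → σ) : Prop :=
  ∀ (A : Type) [CommRing A] (s : Finset A[X]), ∃ T : Finset A, ∀ φ ψ : A →+* K,
    (∀ t ∈ T, c (φ t) = c (ψ t)) → ∀ y, ∃ z, ∀ p ∈ s, c ((p.map φ).eval y) = c ((p.map ψ).eval z)

namespace ColorDetermined

theorem imp (hs : ColorDetermined c s) (ht : ColorDetermined c t) :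
    ColorDetermined c {x | x ∈ s → x ∈ t} := by
  classical
  obtain ⟨T₁, h₁⟩ := hs
  obtain ⟨T₂, h₂⟩ := ht
  exact ⟨T₁ ∪ T₂, fun x y h => imp_congr (h₁ x y fun P hP => h P (Finset.mem_union_left _ hP))
    (h₂ x y fun P hP => h P (Finset.mem_union_right _ hP))⟩

theorem preimage_aeval {β : Type} (hs : ColorDetermined c s) (P : α → MvPolynomial β ℤ) :
    ColorDetermined c {x : β → K | (fun i => MvPolynomial.aeval x (P i)) ∈ s} := by
  classical
  obtain ⟨T, hT⟩ := hs
  refine ⟨T.image (MvPolynomial.aeval P), fun x y h => hT _ _ fun Q hQ => ?_⟩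
  have hcomp : ∀ x : β → K, MvPolynomial.aeval x (MvPolynomial.aeval P Q) =
      MvPolynomial.aeval (fun i => MvPolynomial.aeval x (P i)) Q := fun x =>
    MvPolynomial.comp_aeval_apply P (MvPolynomial.aeval x) Q
  rw [← hcomp, ← hcomp]
  exact h _ (Finset.mem_image_of_mem _ hQ)

theorem exists_elim {s : Set (Option α → K)} (hc : HasColorPatterns c)
    (hs : ColorDetermined c s) :
    ColorDetermined c {x : α → K | ∃ a, (fun o => o.elim a x) ∈ s} := by
  classical
  obtain ⟨F, hF⟩ := hs
  obtain ⟨T, hT⟩ := hc (MvPolynomial α ℤ) (F.image (MvPolynomial.optionEquivLeft ℤ α))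
  suffices h : ∀ x y : α → K,
      (∀ P ∈ T, c (MvPolynomial.aeval x P) = c (MvPolynomial.aeval y P)) →
      (∃ a, (fun o : Option α => o.elim a x) ∈ s) → ∃ b, (fun o : Option α => o.elim b y) ∈ s from
    ⟨T, fun x y hxy => ⟨h x y hxy, h y x fun P hP => (hxy P hP).symm⟩⟩
  rintro x y hxy ⟨a, ha⟩
  obtain ⟨b, hb⟩ := hT (MvPolynomial.aeval x : MvPolynomial α ℤ →ₐ[ℤ] K).toRingHom
    (MvPolynomial.aeval y : MvPolynomial α ℤ →ₐ[ℤ] K).toRingHom hxy a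
  refine ⟨b, (hF _ _ fun P hP => ?_).1 ha⟩
  rw [← eval_map_optionEquivLeft, ← eval_map_optionEquivLeft]
  exact hb _ (Finset.mem_image_of_mem _ hP)

end ColorDetermined

end ColorDetermined

section RelationalExpansion

open FirstOrder FirstOrder.Language FirstOrder.Ring

variable {L : FirstOrder.Language} {K : Type*} [CommRing K] [CompatibleRing K] [L.Structure K]
  {α : Type}

theorem exists_mvPolynomial_realize_eq [L.IsRelational] (t : (Language.ring.sum L).Term α) :
    ∃ P : MvPolynomial α ℤ, ∀ x : α → K, t.realize x = MvPolynomial.aeval x P := by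
  induction t with
  | var i => exact ⟨MvPolynomial.X i, fun x => by rw [MvPolynomial.aeval_X, Term.realize_var]⟩
  | func f ts ih =>
    choose P hP using ih
    rcases f with f | f
    · cases f with
      | add => exact ⟨P 0 + P 1, fun x => (CompatibleRing.funMap_add _).trans (by
          rw [map_add, hP, hP])⟩
      | mul => exact ⟨P 0 * P 1, fun x => (CompatibleRing.funMap_mul _).trans (by
          rw [map_mul, hP, hP])⟩
      | neg => exact ⟨-P 0, fun x => (CompatibleRing.funMap_neg _).trans (by rw [map_neg, hP])⟩
      | zero => exact ⟨0, fun x => (CompatibleRing.funMap_zero _).trans (map_zero _).symm⟩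
      | one => exact ⟨1, fun x => (CompatibleRing.funMap_one _).trans (map_one _).symm⟩
    · exact isEmptyElim f

variable (L K) in
theorem exists_term_realize_eq (P : MvPolynomial α ℤ) :
    ∃ t : (Language.ring.sum L).Term α, ∀ x : α → K, t.realize x = MvPolynomial.aeval x P := by
  obtain ⟨Q, rfl⟩ := (freeCommRingEquivMvPolynomialInt α).surjective P
  refine ⟨LHom.sumInl.onTerm (termOfFreeCommRing Q), fun x => ?_⟩
  rw [LHom.realize_onTerm, realize_termOfFreeCommRing]
  have hlift : FreeCommRing.lift x =
      (MvPolynomial.aeval x : MvPolynomial α ℤ →ₐ[ℤ] K).toRingHom.comp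
        (freeCommRingEquivMvPolynomialInt α).toRingHom :=
    FreeCommRing.hom_ext fun b => by simp [freeCommRingEquivMvPolynomialInt]
  exact RingHom.congr_fun hlift Q

variable {σ : Type*} {c : K → σ}

theorem ColorDetermined.realize_eq [L.IsRelational] (hzero : ∀ a b, c a = c b → (a = 0 ↔ b = 0))
    (t₁ t₂ : (Language.ring.sum L).Term α) :
    ColorDetermined c {x : α → K | t₁.realize x = t₂.realize x} := by
  obtain ⟨P₁, h₁⟩ := exists_mvPolynomial_realize_eq (K := K) t₁
  obtain ⟨P₂, h₂⟩ := exists_mvPolynomial_realize_eq (K := K) t₂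
  have hsub : ∀ x : α → K, t₁.realize x = t₂.realize x ↔ MvPolynomial.aeval x (P₁ - P₂) = 0 :=
    fun x => by rw [map_sub, sub_eq_zero, h₁, h₂]
  refine ⟨{P₁ - P₂}, fun x y h => ?_⟩
  rw [mem_ofPred_eq, mem_ofPred_eq, hsub, hsub]
  exact hzero _ _ (h _ (Finset.mem_singleton_self _))

theorem ColorDetermined.of_isQF [L.IsRelational] (hzero : ∀ a b, c a = c b → (a = 0 ↔ b = 0))
    (hrel : ∀ {m : ℕ} (R : L.Relations m),
      ColorDetermined c {x : Fin m → K | Structure.RelMap R x})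
    {n : ℕ} {φ : (Language.ring.sum L).BoundedFormula α n} (hφ : φ.IsQF) :
    ColorDetermined c {x : α ⊕ Fin n → K | φ.Realize (x ∘ Sum.inl) (x ∘ Sum.inr)} := by
  have hrel' : ∀ {m : ℕ} (R : (Language.ring.sum L).Relations m),
      ColorDetermined c {x : Fin m → K | Structure.RelMap R x} := fun R =>
    Sum.rec isEmptyElim hrel R
  induction hφ with
  | falsum => exact ⟨∅, fun _ _ _ => Iff.rfl⟩
  | of_isAtomic h =>
    cases h with
    | equal t₁ t₂ =>
      simp only [BoundedFormula.realize_bdEqual, Sum.elim_comp_inl_inr]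
      exact .realize_eq hzero t₁ t₂
    | rel R ts =>
      choose P hP using fun i => exists_mvPolynomial_realize_eq (K := K) (ts i)
      simp only [BoundedFormula.realize_rel, Sum.elim_comp_inl_inr, hP]
      exact (hrel' R).preimage_aeval P
  | imp _ _ ih₁ ih₂ => exact ih₁.imp ih₂

theorem ColorDetermined.qfDefinable [Finite σ]
    (hdef : ∀ i, QFDefinable (Language.ring.sum L) {x : Unit → K | c (x ()) = i})
    {s : Set (α → K)} (hs : ColorDetermined c s) : QFDefinable (Language.ring.sum L) s := by
  obtain ⟨T, hT⟩ := hs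
  choose t ht using exists_term_realize_eq (α := α) L K
  let pattern (x : α → K) (P : T) : σ := c (MvPolynomial.aeval x P.1)
  have hpattern : ∀ k : T → σ, QFDefinable (Language.ring.sum L) {x | pattern x = k} := fun k => by
    simp only [funext_iff, pattern, ← ht, ofPred_forall]
    exact .iInter_of_finite fun P => (hdef (k P)).preimage_realize fun _ => t P
  have hunion : s = ⋃ k : pattern '' s, {x | pattern x = k} := by
    ext x
    simp only [iUnion_coe_set, mem_image, iUnion_exists, biUnion_and', iUnion_iUnion_eq_right,
      mem_iUnion, mem_ofPred_eq, exists_prop]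
    exact ⟨fun hx => ⟨x, hx, rfl⟩, fun ⟨y, hy, hxy⟩ =>
      (hT x y fun P hP => congrFun hxy ⟨P, hP⟩).2 hy⟩
  rw [hunion]
  exact .iUnion_of_finite fun k => hpattern k

theorem hasQE_of_hasColorPatterns [L.IsRelational] [Finite σ]
    (hzero : ∀ a b, c a = c b → (a = 0 ↔ b = 0))
    (hrel : ∀ {m : ℕ} (R : L.Relations m),
      ColorDetermined c {x : Fin m → K | Structure.RelMap R x})
    (hdef : ∀ i, QFDefinable (Language.ring.sum L) {x : Unit → K | c (x ()) = i})
    (hc : HasColorPatterns c) : HasQE (inferInstance : (Language.ring.sum L).Structure K) := by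
  refine EliminatesExists.hasQE fun α s hs => ?_
  obtain ⟨θ, hθ, hsθ⟩ := hs
  have hs : ColorDetermined c s := by
    convert (ColorDetermined.of_isQF hzero hrel hθ).preimage_aeval
      (fun i => MvPolynomial.X (Sum.elim id Fin.elim0 i)) using 1
    ext x
    simp only [MvPolynomial.aeval_X, mem_ofPred_eq, hsθ, Formula.Realize]
    exact iff_of_eq (congrArg₂ _ rfl (Subsingleton.elim _ _))
  exact (hs.exists_elim hc).qfDefinable hdef

end RelationalExpansion

/-! ### Algebraically closed fields and the real field -/

section Fields

open FirstOrder FirstOrder.Language FirstOrder.Ring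

variable {L : FirstOrder.Language} {R α : Type*} [CommRing R] [CompatibleRing R] [L.Structure R]

theorem QFDefinable.eq_zero (t : (Language.ring.sum L).Term α) :
    QFDefinable (Language.ring.sum L) {x : α → R | t.realize x = 0} := by
  simpa only [LHom.realize_onTerm, realize_zero] using
    QFDefinable.term_eq (M := R) t (LHom.sumInl.onTerm 0)

theorem hasColorPatterns_eq_zero (K : Type*) [Field K] [IsAlgClosed K] :
    HasColorPatterns (fun a : K => a = 0) := by
  intro A _ s
  obtain ⟨T, hT⟩ := exists_finset_forall_isRoot_iff (K := K) s
  refine ⟨T, fun φ ψ h y => ?_⟩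
  obtain ⟨z, hz⟩ := hT φ ψ (fun t ht => (h t ht).to_iff) y
  exact ⟨z, fun p hp => propext (hz p hp)⟩

theorem hasQE_of_isAlgClosed (K : Type*) [Field K] [IsAlgClosed K]
    (S : FirstOrder.Language.empty.Structure K) : HasQE (ringExpansion K S) := by
  let := compatibleRingOfRing K
  refine hasQE_of_hasColorPatterns (L := FirstOrder.Language.empty) (c := fun a : K => a = 0)
    (fun a b h => h.to_iff) (fun R => isEmptyElim R) (fun i => ?_) (hasColorPatterns_eq_zero K)
  have hzero : QFDefinable (Language.ring.sum FirstOrder.Language.empty)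
      {x : Unit → K | x () = 0} := .eq_zero (Term.var ())
  by_cases hi : i
  · simp only [hi, eq_iff_iff, iff_true]
    exact hzero
  · simp only [hi, eq_iff_iff, iff_false]
    exact hzero.compl

theorem QFDefinable.realize_le (t₁ t₂ : (Language.ring.sum Language.order).Term α) :
    letI := ringExpansion ℝ (orderStructure ℝ)
    QFDefinable (Language.ring.sum Language.order) {x : α → ℝ | t₁.realize x ≤ t₂.realize x} :=
  letI := ringExpansion ℝ (orderStructure ℝ)
  QFDefinable.rel (L := Language.ring.sum Language.order) (M := ℝ) (Sum.inr orderRel.le) ![t₁, t₂]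

theorem QFDefinable.sign_eq (i : SignType) :
    letI := ringExpansion ℝ (orderStructure ℝ)
    QFDefinable (Language.ring.sum Language.order) {x : Unit → ℝ | sign (x ()) = i} := by
  let := compatibleRingOfRing ℝ
  let := orderStructure ℝ
  have hnonpos := QFDefinable.realize_le (Term.var ()) (LHom.sumInl.onTerm 0)
  have hnonneg := QFDefinable.realize_le (LHom.sumInl.onTerm 0) (Term.var ())
  simp only [LHom.realize_onTerm, realize_zero, Term.realize_var] at hnonpos hnonneg
  cases i
  · convert hnonpos.inter hnonneg using 1
    ext x
    exact sign_eq_zero_iff.trans le_antisymm_iff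
  · convert hnonneg.compl using 1
    ext x
    exact sign_eq_neg_one_iff.trans not_le.symm
  · convert hnonpos.compl using 1
    ext x
    exact sign_eq_one_iff.trans not_le.symm

theorem colorDetermined_sign_le : ColorDetermined sign {x : Fin 2 → ℝ | x 0 ≤ x 1} := by
  refine ⟨{MvPolynomial.X 0 - MvPolynomial.X 1}, fun x y h => ?_⟩
  replace h := h _ (Finset.mem_singleton_self _)
  simp only [map_sub, MvPolynomial.aeval_X] at h
  rw [mem_ofPred_eq, mem_ofPred_eq, ← sub_nonpos, ← sub_nonpos (a := y 0), ← sign_nonpos_iff, h,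
    sign_nonpos_iff]

theorem hasColorPatterns_sign : HasColorPatterns (sign : ℝ → SignType) :=
  fun _ _ s => exists_finset_forall_sign_eval_eq s

theorem hasQE_real : HasQE (ringExpansion ℝ (orderStructure ℝ)) := by
  let := compatibleRingOfRing ℝ
  let := orderStructure ℝ
  exact hasQE_of_hasColorPatterns (L := Language.order) (c := (sign : ℝ → SignType))
    (fun a b h => by rw [← sign_eq_zero_iff, h, sign_eq_zero_iff])
    (fun R => by cases R; exact colorDetermined_sign_le) QFDefinable.sign_eq hasColorPatterns_sign

end Fields

/-! ### Structures with definable coordinates -/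

section Coordinates

open FirstOrder FirstOrder.Language

variable {L L' : FirstOrder.Language} {F M N α : Type*} [L.Structure F] [L'.Structure M]

/-- The tuple of elements of `M` with the given coordinates. -/
def ofCoords (co : M ≃ (N → F)) (w : α × N → F) (i : α) : M :=
  co.symm fun p => w (i, p)

/-- The coordinates `co` interpret the `L'`-structure `M` in the `L`-structure `F`: the coordinates
of the values of function symbols, and the relations between tuples of elements, are definable
in terms of the coordinates. -/
structure HasDefinableCoords (L L' : FirstOrder.Language) {F M N : Type*} [L.Structure F]
    [L'.Structure M] (co : M ≃ (N → F)) : Prop where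
  definableFun_funMap {m : ℕ} (f : L'.Functions m) (p : N) : (∅ : Set F).DefinableFun L
    fun w : Fin m × N → F => co (Structure.funMap f (ofCoords co w)) p
  definable_relMap {m : ℕ} (R : L'.Relations m) : (∅ : Set F).Definable L
    {w : Fin m × N → F | Structure.RelMap R (ofCoords co w)}

theorem ofCoords_coords (co : M ≃ (N → F)) (A : α → M) :
    ofCoords co (fun q => co (A q.1) q.2) = A :=
  funext fun i => co.symm_apply_apply (A i)

namespace HasDefinableCoords

variable {co : M ≃ (N → F)} [Finite N]

theorem definableFun_realize (h : HasDefinableCoords L L' co) (t : L'.Term α) (p : N) :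
    (∅ : Set F).DefinableFun L fun w : α × N → F => co (t.realize (ofCoords co w)) p := by
  induction t generalizing p with
  | var i =>
    simp only [Term.realize_var, ofCoords, Equiv.apply_symm_apply]
    exact Set.DefinableFun.proj L
  | func f ts ih =>
    have hcomp := Set.DefinableFun.comp
      (g := fun (w : α × N → F) (q : Fin _ × N) => co ((ts q.1).realize (ofCoords co w)) q.2)
      (fun q => ih q.1 q.2) (h.definableFun_funMap f p)
    have hcoords (w : α × N → F) :
        ofCoords co (fun q => co ((ts q.1).realize (ofCoords co w)) q.2) =
          fun i => (ts i).realize (ofCoords co w) :=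
      ofCoords_coords co fun i => (ts i).realize (ofCoords co w)
    simpa only [hcoords, Term.realize_func] using hcomp

theorem definable_realize_eq (h : HasDefinableCoords L L' co) (t₁ t₂ : L'.Term α) :
    (∅ : Set F).Definable L
      {w : α × N → F | t₁.realize (ofCoords co w) = t₂.realize (ofCoords co w)} := by
  convert Set.definable_iInter_of_finite fun p =>
    (h.definableFun_realize t₁ p).ofPred_eq (h.definableFun_realize t₂ p) using 1
  ext w
  rw [mem_ofPred_eq, ← co.injective.eq_iff, funext_iff]
  simp only [mem_iInter, mem_ofPred_eq]

theorem definable_relMap_realize (h : HasDefinableCoords L L' co) {m : ℕ} (R : L'.Relations m)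
    (ts : Fin m → L'.Term α) :
    (∅ : Set F).Definable L
      {w : α × N → F | Structure.RelMap R fun i => (ts i).realize (ofCoords co w)} := by
  convert (h.definable_relMap R).preimage_map (fun q : Fin m × N =>
    h.definableFun_realize (ts q.1) q.2) using 1
  ext w
  rw [mem_preimage, mem_ofPred_eq, mem_ofPred_eq,
    ofCoords_coords co fun i => (ts i).realize (ofCoords co w)]

theorem definable_forall {n : ℕ} {P : (α ⊕ Fin (n + 1) → M) → Prop}
    (hP : (∅ : Set F).Definable L {w | P (ofCoords co w)}) :
    (∅ : Set F).Definable L {w : (α ⊕ Fin n) × N → F | ∀ a, P (Sum.elim (ofCoords co w ∘ Sum.inl)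
      (Fin.snoc (α := fun _ => M) (ofCoords co w ∘ Sum.inr) a))} := by
  let r : α ⊕ Fin (n + 1) → N → ((α ⊕ Fin n) × N) ⊕ N :=
    Sum.elim (fun i p => .inl (.inl i, p))
      (Fin.snoc (α := fun _ => N → ((α ⊕ Fin n) × N) ⊕ N) (fun j p => .inl (.inr j, p)) .inr)
  convert (hP.preimage_comp fun q : (α ⊕ Fin (n + 1)) × N => r q.1 q.2).forall_of_finite using 1
  ext w
  simp only [mem_ofPred_eq, mem_preimage]
  rw [← co.symm.forall_congr_right]
  refine forall_congr' fun v => iff_of_eq (congrArg P (funext fun i => ?_))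
  rcases i with i | i
  · rfl
  · refine Fin.lastCases ?_ (fun j => ?_) i
    · simp [ofCoords, r]
    · simp [ofCoords, r]

theorem definable_realize (h : HasDefinableCoords L L' co) {n : ℕ} (φ : L'.BoundedFormula α n) :
    (∅ : Set F).Definable L {w : (α ⊕ Fin n) × N → F |
      φ.Realize (ofCoords co w ∘ Sum.inl) (ofCoords co w ∘ Sum.inr)} := by
  induction φ with
  | falsum => exact Set.definable_empty
  | equal t₁ t₂ =>
    simp only [BoundedFormula.Realize, Sum.elim_comp_inl_inr]
    exact h.definable_realize_eq t₁ t₂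
  | rel R ts =>
    simp only [BoundedFormula.Realize, Sum.elim_comp_inl_inr]
    exact h.definable_relMap_realize R ts
  | imp φ₁ φ₂ ih₁ ih₂ =>
    simp only [BoundedFormula.realize_imp, imp_iff_not_or]
    exact ih₁.compl.union ih₂
  | all φ ih =>
    exact definable_forall (P := fun x => φ.Realize (x ∘ Sum.inl) (x ∘ Sum.inr)) ih

end HasDefinableCoords

theorem isQF_onBoundedFormula (g : L →ᴸ L') {n : ℕ} {φ : L.BoundedFormula α n} (h : φ.IsQF) :
    (g.onBoundedFormula φ).IsQF := by
  induction h with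
  | falsum => exact .falsum
  | of_isAtomic h =>
    cases h with
    | equal t₁ t₂ => exact (BoundedFormula.IsAtomic.equal _ _).isQF
    | rel R ts => exact (BoundedFormula.IsAtomic.rel _ _).isQF
  | imp _ _ h₁ h₂ => exact h₁.imp h₂

theorem HasQE.qfDefinable [Finite α] (h : HasQE (inferInstance : L.Structure F))
    {s : Set (α → F)} (hs : (∅ : Set F).Definable L s) : QFDefinable L s := by
  obtain ⟨k, ⟨r⟩⟩ := Finite.exists_equiv_fin α
  obtain ⟨θ, hθ⟩ := Set.empty_definable_iff.1 (hs.preimage_comp r)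
  obtain ⟨ψ, hψ, hθψ⟩ := h k θ
  have hQF : QFDefinable L {x : Fin k → F | x ∘ r ∈ s} :=
    ⟨ψ, hψ, fun x => (Set.ext_iff.1 hθ x).trans (hθψ x)⟩
  simpa only [mem_ofPred_eq, Function.comp_assoc, r.symm_comp_self, Function.comp_id,
    ofPred_mem_eq] using hQF.preimage_comp r.symm

theorem QFDefinable.preimage_coords [L.Structure M] (g : L →ᴸ L') [g.IsExpansionOn M]
    (ι : F ↪[L] M) {co : M → N → F} {τ : N → L'.Term Unit}
    (hτ : ∀ p A, (τ p).realize (fun _ => A) = ι (co A p)) {s : Set (α × N → F)}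
    (hs : QFDefinable L s) : QFDefinable L' {x : α → M | (fun q => co (x q.1) q.2) ∈ s} := by
  obtain ⟨ψ, hψ, hsψ⟩ := hs
  have hM : QFDefinable L' {y : α × N → M | ψ.Realize y} :=
    ⟨g.onFormula ψ, isQF_onBoundedFormula g hψ, fun y => (g.realize_onFormula ψ).symm⟩
  convert hM.preimage_realize fun q => (τ q.2).relabel fun _ => q.1 using 1
  ext x
  simp only [mem_ofPred_eq, hsψ, Term.realize_relabel, Function.comp_def, hτ]
  rw [Formula.Realize, ← hψ.realize_embedding ι]
  exact iff_of_eq (congrArg₂ _ rfl (Subsingleton.elim _ _))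

theorem HasDefinableCoords.hasQE [Finite N] {co : M ≃ (N → F)} (h : HasDefinableCoords L L' co)
    [L.Structure M] (g : L →ᴸ L') [g.IsExpansionOn M] (ι : F ↪[L] M) {τ : N → L'.Term Unit}
    (hτ : ∀ p A, (τ p).realize (fun _ => A) = ι (co A p))
    (hF : HasQE (inferInstance : L.Structure F)) : HasQE (inferInstance : L'.Structure M) := by
  intro k φ
  have hdef := (hF.qfDefinable (h.definable_realize φ)).preimage_coords g ι hτ
  obtain ⟨ψ, hψ, hφψ⟩ := hdef.preimage_comp (Sum.elim id (Fin.elim0 (α := Fin k)))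
  refine ⟨ψ, hψ, fun x => ?_⟩
  rw [← hφψ x, mem_ofPred_eq, mem_ofPred_eq, mem_ofPred_eq, Formula.Realize,
    ofCoords_coords co (x ∘ Sum.elim id Fin.elim0)]
  exact iff_of_eq (congrArg₂ _ rfl (Subsingleton.elim _ _))

end Coordinates

/-! ### Matrix rings -/

namespace IsMatrixUnits

variable {F : Type*} [Field F] {n : ℕ} {e : Fin n → Fin n → Matrix (Fin n) (Fin n) F}

theorem exists_algEquiv (he : IsMatrixUnits e) :
    ∃ Φ : Matrix (Fin n) (Fin n) F ≃ₐ[F] Matrix (Fin n) (Fin n) F,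
      ∀ i j, Φ (stdUnits F n i j) = e i j := by
  let Φ : Matrix (Fin n) (Fin n) F →ₗ[F] Matrix (Fin n) (Fin n) F :=
    Matrix.liftLinear F fun i j => LinearMap.toSpanSingleton F _ (e i j)
  have hsingle (i j : Fin n) (a : F) : Φ (Matrix.single i j a) = a • e i j :=
    Matrix.liftLinear_single F _ i j a
  have hmul : ∀ A B, Φ (A * B) = Φ A * Φ B := by
    rw [LinearMap.map_mul_iff]
    refine Matrix.ext_linearMap F fun i j => LinearMap.ext fun a =>
      Matrix.ext_linearMap F fun s t => LinearMap.ext fun b => ?_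
    change Φ (Matrix.single i j a * Matrix.single s t b) =
      Φ (Matrix.single i j a) * Φ (Matrix.single s t b)
    rw [hsingle, hsingle, smul_mul_smul_comm]
    obtain rfl | hjs := eq_or_ne j s
    · rw [Matrix.single_mul_single_same, hsingle, he.mul_same]
    · rw [Matrix.single_mul_single_of_ne _ _ _ _ hjs, he.mul_of_ne _ _ _ _ hjs, map_zero, smul_zero]
  have hinj : Function.Injective Φ := by
    refine (injective_iff_map_eq_zero Φ).2 fun A hA => Matrix.ext fun i j => ?_
    have hij : A i j • e i j = 0 := by
      rw [← hsingle, ← one_mul (A i j), ← mul_one (1 * A i j), ← Matrix.single_mul_mul_single,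
        hmul, hmul, hA, mul_zero, zero_mul]
    exact (smul_eq_zero.1 hij).resolve_right (he.ne_zero i j)
  let Φ' := LinearEquiv.ofInjectiveEndo Φ hinj
  have hone : Φ 1 = 1 := by
    obtain ⟨A, hA⟩ : ∃ A, Φ A = 1 := Φ'.surjective 1
    calc Φ 1 = Φ 1 * Φ A := by rw [hA, mul_one]
      _ = Φ A := by rw [← hmul, one_mul]
      _ = 1 := hA
  exact ⟨AlgEquiv.ofLinearEquiv Φ' hone hmul, fun i j => (hsingle i j 1).trans (one_smul F _)⟩

end IsMatrixUnits

section MatrixStructure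

open FirstOrder FirstOrder.Language FirstOrder.Ring

variable {L : FirstOrder.Language.{u, v}} {F : Type w} [Field F] {n k : ℕ}

theorem map_funMap_ring {R R' : Type*} [Ring R] [Ring R'] [CompatibleRing R] [CompatibleRing R']
    (g : R →+* R') (f : Language.ring.Functions k) (x : Fin k → R) :
    g (Structure.funMap f x) = Structure.funMap f (g ∘ x) := by
  cases f <;> simp

theorem funMap_centerStructure_of_not (S : L.Structure F) (f : L.Functions k)
    {A : Fin k → Matrix (Fin n) (Fin n) F} (h : ¬ ∃ a, IsCentralTuple A a) :
    (centerStructure S n).funMap f A = 0 :=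
  dif_neg h

theorem isCentralTuple_comp_algEquiv_iff
    (Φ : Matrix (Fin n) (Fin n) F ≃ₐ[F] Matrix (Fin n) (Fin n) F)
    {A : Fin k → Matrix (Fin n) (Fin n) F} {a : Fin k → F} :
    IsCentralTuple (Φ ∘ A) a ↔ IsCentralTuple A a :=
  forall_congr' fun i => (iff_of_eq (congrArg (Φ (A i) = ·) (Φ.commutes (a i)).symm)).trans
    Φ.injective.eq_iff

variable [NeZero n]

theorem IsCentralTuple.unique {A : Fin k → Matrix (Fin n) (Fin n) F} {a b : Fin k → F}
    (ha : IsCentralTuple A a) (hb : IsCentralTuple A b) : a = b :=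
  funext fun i => Matrix.scalar_inj.1 ((ha i).symm.trans (hb i))

theorem funMap_centerStructure (S : L.Structure F) (f : L.Functions k)
    {A : Fin k → Matrix (Fin n) (Fin n) F} {a : Fin k → F} (ha : IsCentralTuple A a) :
    (centerStructure S n).funMap f A = Matrix.scalar (Fin n) (S.funMap f a) := by
  have h : ∃ a, IsCentralTuple A a := ⟨a, ha⟩
  exact (dif_pos h).trans (by rw [h.choose_spec.unique ha])

theorem relMap_centerStructure (S : L.Structure F) (R : L.Relations k)
    {A : Fin k → Matrix (Fin n) (Fin n) F} {a : Fin k → F} (ha : IsCentralTuple A a) :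
    (centerStructure S n).RelMap R A ↔ S.RelMap R a :=
  ⟨fun ⟨_, hb, h⟩ => hb.unique ha ▸ h, fun h => ⟨a, ha, h⟩⟩

variable (n) in
/-- The embedding of a field with additional structure into its matrix ring. -/
def scalarEmbedding (S : L.Structure F) :
    letI := ringExpansion F S
    letI := matrixExpansion S n
    F ↪[Language.ring.sum L] Matrix (Fin n) (Fin n) F :=
  letI := compatibleRingOfRing F
  letI := compatibleRingOfRing (Matrix (Fin n) (Fin n) F)
  letI := ringExpansion F S
  letI := matrixExpansion S n
  { toFun := fun a => Matrix.scalar (Fin n) a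
    inj' := fun _ _ h => Matrix.scalar_inj.1 h
    map_fun' := by
      rintro k (f | f) x
      · exact map_funMap_ring (Matrix.scalar (Fin n)) f x
      · exact (funMap_centerStructure S f fun _ => rfl).symm
    map_rel' := by
      rintro k (R | R) x
      · exact isEmptyElim R
      · exact relMap_centerStructure S R fun _ => rfl }

/-! ### Change of matrix units -/

theorem map_funMap_centerStructure (S : L.Structure F)
    (Φ : Matrix (Fin n) (Fin n) F ≃ₐ[F] Matrix (Fin n) (Fin n) F) (f : L.Functions k)
    (A : Fin k → Matrix (Fin n) (Fin n) F) :
    Φ ((centerStructure S n).funMap f A) = (centerStructure S n).funMap f (Φ ∘ A) := by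
  by_cases h : ∃ a, IsCentralTuple A a
  · obtain ⟨a, ha⟩ := h
    rw [funMap_centerStructure S f ha,
      funMap_centerStructure S f ((isCentralTuple_comp_algEquiv_iff Φ).2 ha)]
    exact Φ.commutes _
  · rw [funMap_centerStructure_of_not S f h, funMap_centerStructure_of_not S f (by
      simpa only [isCentralTuple_comp_algEquiv_iff] using h), map_zero]

/-- The isomorphism of expansions of the matrix ring by constants given by an algebra
automorphism. -/
def algEquivNameConstants (S : L.Structure F) (e : Fin n → Fin n → Matrix (Fin n) (Fin n) F)
    (Φ : Matrix (Fin n) (Fin n) F ≃ₐ[F] Matrix (Fin n) (Fin n) F) :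
    @FirstOrder.Language.Equiv ((Language.ring.sum L).withConstants (Fin n × Fin n))
      (Matrix (Fin n) (Fin n) F) (Matrix (Fin n) (Fin n) F)
      (nameConstants (matrixExpansion S n) e)
      (nameConstants (matrixExpansion S n) fun i j => Φ (e i j)) :=
  letI := compatibleRingOfRing (Matrix (Fin n) (Fin n) F)
  @FirstOrder.Language.Equiv.mk _ _ _ (nameConstants (matrixExpansion S n) e)
    (nameConstants (matrixExpansion S n) fun i j => Φ (e i j)) Φ.toEquiv
    (by
      rintro k ((f | f) | c) A
      · exact map_funMap_ring (Φ : Matrix (Fin n) (Fin n) F →+* Matrix (Fin n) (Fin n) F) f A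
      · exact map_funMap_centerStructure S Φ f A
      · cases k with
        | zero => rfl
        | succ k => exact isEmptyElim c)
    (by
      rintro k ((R | R) | R) A
      · exact isEmptyElim R
      · exact exists_congr fun a => and_congr_left' (isCentralTuple_comp_algEquiv_iff Φ)
      · exact isEmptyElim R)

theorem HasQE.of_equiv {L' : FirstOrder.Language} {M N : Type*} [L'.Structure M] [L'.Structure N]
    (g : M ≃[L'] N) (h : HasQE (inferInstance : L'.Structure M)) :
    HasQE (inferInstance : L'.Structure N) := by
  intro k φ
  obtain ⟨ψ, hψ, hφψ⟩ := h k φ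
  refine ⟨ψ, hψ, fun x => ?_⟩
  rw [← StrongHomClass.realize_formula g.symm, hφψ, StrongHomClass.realize_formula g.symm]

theorem IsMatrixUnits.hasQE_nameConstants {e : Fin n → Fin n → Matrix (Fin n) (Fin n) F}
    (he : IsMatrixUnits e) (S : L.Structure F)
    (h : HasQE (nameConstants (matrixExpansion S n) (stdUnits F n))) :
    HasQE (nameConstants (matrixExpansion S n) e) := by
  obtain ⟨Φ, hΦ⟩ := he.exists_algEquiv
  obtain rfl : (fun i j => Φ (stdUnits F n i j)) = e := funext₂ hΦ
  exact @HasQE.of_equiv _ _ _ (_) (_) (algEquivNameConstants S (stdUnits F n) Φ) h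

end MatrixStructure

/-! ### Matrix entries as coordinates -/

section Entries

open FirstOrder FirstOrder.Language FirstOrder.Ring

variable {L : FirstOrder.Language.{u, v}} {F : Type w} [Field F] {n k : ℕ}

/-- The identification of a matrix with the family of its entries. -/
def entries (m n R : Type*) : Matrix m n R ≃ (m × n → R) :=
  (Equiv.curry m n R).symm

theorem entries_apply {m l R : Type*} (A : Matrix m l R) (p : m × l) :
    entries m l R A p = A p.1 p.2 :=
  rfl

theorem ofCoords_entries_apply {α m l R : Type*} (w : α × (m × l) → R) (i : α) (r : m) (s : l) :
    ofCoords (entries m l R) w i r s = w (i, (r, s)) :=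
  rfl

variable (n) in
theorem exists_mvPolynomial_entries_funMap (R : Type*) [CommRing R]
    [CompatibleRing (Matrix (Fin n) (Fin n) R)] (f : Language.ring.Functions k)
    (p : Fin n × Fin n) :
    ∃ P : MvPolynomial (Fin k × (Fin n × Fin n)) ℤ, ∀ w : Fin k × (Fin n × Fin n) → R,
      entries _ _ R (Structure.funMap f (ofCoords (entries _ _ R) w)) p =
        MvPolynomial.aeval w P := by
  obtain ⟨r, s⟩ := p
  cases f with
  | add => exact ⟨.X (0, (r, s)) + .X (1, (r, s)), fun w => by
      simp [entries_apply, ofCoords_entries_apply]⟩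
  | mul => exact ⟨∑ t, .X (0, (r, t)) * .X (1, (t, s)), fun w => by
      simp [entries_apply, ofCoords_entries_apply, Matrix.mul_apply]⟩
  | neg => exact ⟨-.X (0, (r, s)), fun w => by
      simp [entries_apply, ofCoords_entries_apply]⟩
  | zero => exact ⟨0, fun w => by simp [entries_apply]⟩
  | one => exact ⟨if r = s then 1 else 0, fun w => by
      rw [CompatibleRing.funMap_one, entries_apply, Matrix.one_apply,
        apply_ite (MvPolynomial.aeval w), map_one (MvPolynomial.aeval w), map_zero]⟩

theorem definableFun_aeval {R : Type*} [CommRing R] [CompatibleRing R] [L.Structure R] {α : Type}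
    (P : MvPolynomial α ℤ) :
    (∅ : Set R).DefinableFun (Language.ring.sum L) fun w : α → R => MvPolynomial.aeval w P := by
  obtain ⟨t, ht⟩ := exists_term_realize_eq L R P
  simpa only [ht] using t.definableFun_realize (M := R)

theorem definableFun_zero {R : Type*} [CommRing R] [CompatibleRing R] [L.Structure R] {α : Type} :
    (∅ : Set R).DefinableFun (Language.ring.sum L) fun _ : α → R => (0 : R) := by
  simpa only [map_zero] using definableFun_aeval (R := R) (0 : MvPolynomial α ℤ)

theorem definableFun_entries_stdUnits (S : L.Structure F) {α : Type} (i j : Fin n)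
    (p : Fin n × Fin n) :
    letI := ringExpansion F S
    (∅ : Set F).DefinableFun (Language.ring.sum L)
      fun _ : α → F => entries _ _ F (stdUnits F n i j) p := by
  let := compatibleRingOfRing F
  convert definableFun_aeval (L := L) (R := F) (α := α)
    (if i = p.1 ∧ j = p.2 then 1 else 0) using 2
  rw [apply_ite (MvPolynomial.aeval _), map_one, map_zero]
  exact Matrix.single_apply i j 1 p.1 p.2

theorem sum_stdUnits_mul_mul (A : Matrix (Fin n) (Fin n) F) (i j : Fin n) :
    ∑ t, stdUnits F n t i * A * stdUnits F n j t = Matrix.scalar (Fin n) (A i j) := by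
  simp only [Matrix.single_mul_mul_single, one_mul, mul_one, Matrix.scalar_apply]
  exact Matrix.sum_single_eq_diagonal _

theorem isCentralTuple_ofCoords_iff {w : Fin k × (Fin n × Fin n) → F} {a : Fin k → F} :
    IsCentralTuple (ofCoords (entries _ _ F) w) a ↔
      ∀ i p, w (i, p) = if p.1 = p.2 then a i else 0 := by
  simp only [IsCentralTuple, ← Matrix.ext_iff, ofCoords_entries_apply, Matrix.scalar_apply,
    Matrix.diagonal_apply, Prod.forall]

theorem exists_term_realize_sum {L' : FirstOrder.Language} {R α ι : Type*} [Ring R]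
    [CompatibleRing R] [L'.Structure R] (g : Language.ring →ᴸ L') [g.IsExpansionOn R]
    (s : Finset ι) (t : ι → L'.Term α) :
    ∃ τ : L'.Term α, ∀ x : α → R, τ.realize x = ∑ i ∈ s, (t i).realize x := by
  classical
  induction s using Finset.induction_on with
  | empty => exact ⟨g.onTerm 0, fun x => by simp⟩
  | insert i s hi ih =>
    obtain ⟨τ, hτ⟩ := ih
    refine ⟨(g.onTerm (Term.var 0 + Term.var 1 : Language.ring.Term (Fin 2))).subst ![t i, τ],
      fun x => ?_⟩
    simp [Finset.sum_insert hi, Term.realize_subst, hτ]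

theorem exists_term_realize_eq_entries (S : L.Structure F) (p : Fin n × Fin n) :
    letI := nameConstants (matrixExpansion S n) (stdUnits F n)
    ∃ τ : ((Language.ring.sum L).withConstants (Fin n × Fin n)).Term Unit,
      ∀ A : Matrix (Fin n) (Fin n) F, τ.realize (fun _ => A) =
        Matrix.scalar (Fin n) (entries _ _ F A p) := by
  let := compatibleRingOfRing (Matrix (Fin n) (Fin n) F)
  let := nameConstants (matrixExpansion S n) (stdUnits F n)
  let g : Language.ring →ᴸ (Language.ring.sum L).withConstants (Fin n × Fin n) :=
    LHom.sumInl.comp LHom.sumInl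
  have : g.IsExpansionOn (Matrix (Fin n) (Fin n) F) := ⟨fun _ _ => rfl, fun _ _ => rfl⟩
  let c (i j : Fin n) : ((Language.ring.sum L).withConstants (Fin n × Fin n)).Term Unit :=
    ((Language.ring.sum L).con (i, j)).term
  have hc (i j : Fin n) (x : Unit → Matrix (Fin n) (Fin n) F) :
      (c i j).realize x = stdUnits F n i j := rfl
  obtain ⟨τ, hτ⟩ := exists_term_realize_sum (R := Matrix (Fin n) (Fin n) F) g Finset.univ fun t =>
    (g.onTerm (Term.var 0 * Term.var 1 * Term.var 2 : Language.ring.Term (Fin 3))).subst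
      ![c t p.1, Term.var (), c p.2 t]
  refine ⟨τ, fun A => ?_⟩
  rw [hτ, entries_apply, ← sum_stdUnits_mul_mul]
  refine Finset.sum_congr rfl fun t _ => ?_
  rw [Term.realize_subst, LHom.realize_onTerm]
  simp [hc]

variable [NeZero n]

/-- The tuples of entries of tuples of scalar matrices. -/
def IsCentralCoords (w : Fin k × (Fin n × Fin n) → F) : Prop :=
  ∀ i p, w (i, p) = if p.1 = p.2 then w (i, (0, 0)) else 0

theorem IsCentralCoords.isCentralTuple {w : Fin k × (Fin n × Fin n) → F} (h : IsCentralCoords w) :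
    IsCentralTuple (ofCoords (entries _ _ F) w) fun i => w (i, (0, 0)) :=
  isCentralTuple_ofCoords_iff.2 h

theorem exists_isCentralTuple_iff {w : Fin k × (Fin n × Fin n) → F} :
    (∃ a, IsCentralTuple (ofCoords (entries _ _ F) w) a) ↔ IsCentralCoords w := by
  refine ⟨fun ⟨a, ha⟩ i p => ?_, fun h => ⟨_, h.isCentralTuple⟩⟩
  rw [isCentralTuple_ofCoords_iff] at ha
  rw [ha i p, ha i (0, 0), if_pos rfl]

theorem definable_isCentralCoords (S : L.Structure F) :
    letI := ringExpansion F S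
    (∅ : Set F).Definable (Language.ring.sum L)
      (Set.ofPred fun w : Fin k × (Fin n × Fin n) → F => IsCentralCoords w) := by
  let := compatibleRingOfRing F
  simp only [IsCentralCoords, ofPred_forall]
  refine Set.definable_iInter_of_finite fun i => Set.definable_iInter_of_finite fun p => ?_
  refine Set.DefinableFun.ofPred_eq (Set.DefinableFun.proj _) ?_
  split_ifs
  · exact Set.DefinableFun.proj _
  · exact definableFun_zero

theorem definableFun_entries_funMap_centerStructure (S : L.Structure F) (f : L.Functions k)
    (p : Fin n × Fin n) :
    letI := ringExpansion F S
    (∅ : Set F).DefinableFun (Language.ring.sum L) fun w : Fin k × (Fin n × Fin n) → F =>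
      entries _ _ F ((centerStructure S n).funMap f (ofCoords (entries _ _ F) w)) p := by
  classical
  let := compatibleRingOfRing F
  have hf (w : Fin k × (Fin n × Fin n) → F) :
      entries _ _ F ((centerStructure S n).funMap f (ofCoords (entries _ _ F) w)) p =
        if IsCentralCoords w then
          if p.1 = p.2 then S.funMap f fun i => w (i, (0, 0)) else 0
        else 0 := by
    by_cases hw : IsCentralCoords w
    · rw [if_pos hw, funMap_centerStructure S f hw.isCentralTuple]
      rfl
    · rw [if_neg hw, funMap_centerStructure_of_not S f (by rwa [exists_isCentralTuple_iff])]
      rfl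
  simp only [hf]
  refine Set.DefinableFun.ite (definable_isCentralCoords S) ?_ definableFun_zero
  split_ifs
  · exact Set.DefinableFun.comp (L := Language.ring.sum L)
      (g := fun (w : Fin k × (Fin n × Fin n) → F) i => w (i, (0, 0)))
      (fun i => Set.DefinableFun.proj _)
      (Set.DefinableFun.fun_symbol (L := Language.ring.sum L) (Sum.inr f))
  · exact definableFun_zero

theorem definable_relMap_centerStructure (S : L.Structure F) (R : L.Relations k) :
    letI := ringExpansion F S
    (∅ : Set F).Definable (Language.ring.sum L) {w : Fin k × (Fin n × Fin n) → F |
      (centerStructure S n).RelMap R (ofCoords (entries _ _ F) w)} := by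
  let := ringExpansion F S
  have hR : (∅ : Set F).Definable (Language.ring.sum L) {x : Fin k → F | S.RelMap R x} :=
    Set.empty_definable_iff.2
      ⟨Relations.formula (L := Language.ring.sum L) (Sum.inr R) Term.var, rfl⟩
  convert (definable_isCentralCoords S).inter
    (hR.preimage_comp fun i : Fin k => (i, ((0 : Fin n), (0 : Fin n)))) using 1
  ext w
  refine ⟨fun hw => ?_, fun ⟨hc, hw⟩ => (relMap_centerStructure S R hc.isCentralTuple).2 hw⟩
  have hc : IsCentralCoords w := exists_isCentralTuple_iff.1 (hw.imp fun _ h => h.1)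
  exact ⟨hc, (relMap_centerStructure S R hc.isCentralTuple).1 hw⟩

theorem hasDefinableCoords_entries (S : L.Structure F) :
    letI := ringExpansion F S
    letI := nameConstants (matrixExpansion S n) (stdUnits F n)
    HasDefinableCoords (Language.ring.sum L) ((Language.ring.sum L).withConstants (Fin n × Fin n))
      (entries (Fin n) (Fin n) F) := by
  let := compatibleRingOfRing F
  let := compatibleRingOfRing (Matrix (Fin n) (Fin n) F)
  let := nameConstants (matrixExpansion S n) (stdUnits F n)
  constructor
  · rintro k ((f | f) | c) p
    · obtain ⟨P, hP⟩ := exists_mvPolynomial_entries_funMap n F f p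
      exact (funext hP) ▸ definableFun_aeval P
    · exact definableFun_entries_funMap_centerStructure S f p
    · cases k with
      | zero => exact definableFun_entries_stdUnits S c.1 c.2 p
      | succ k => exact isEmptyElim c
  · rintro k ((R | R) | R)
    · exact isEmptyElim R
    · exact definable_relMap_centerStructure S R
    · exact isEmptyElim R

theorem hasQE_nameConstants_stdUnits (S : L.Structure F) (hF : HasQE (ringExpansion F S)) :
    HasQE (nameConstants (matrixExpansion S n) (stdUnits F n)) := by
  let := ringExpansion F S
  let := matrixExpansion S n
  let := nameConstants (matrixExpansion S n) (stdUnits F n)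
  choose τ hτ using exists_term_realize_eq_entries (n := n) S
  let g := (Language.ring.sum L).lhomWithConstants (Fin n × Fin n)
  have : g.IsExpansionOn (Matrix (Fin n) (Fin n) F) := ⟨fun _ _ => rfl, fun _ _ => rfl⟩
  exact (hasDefinableCoords_entries S).hasQE g (scalarEmbedding n S) hτ hF

end Entries

/-! ### Matrix rings over the complex and the real field -/

section Examples

open FirstOrder FirstOrder.Language

theorem HasQE.of_lhom {L L' : FirstOrder.Language} {M : Type*} [L.Structure M] [L'.Structure M]
    (f : L →ᴸ L') (g : L' →ᴸ L) [f.IsExpansionOn M] [g.IsExpansionOn M]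
    (h : HasQE (inferInstance : L.Structure M)) : HasQE (inferInstance : L'.Structure M) := by
  intro k φ
  obtain ⟨ψ, hψ, hφψ⟩ := h k (g.onFormula φ)
  refine ⟨f.onFormula ψ, isQF_onBoundedFormula f hψ, fun x => ?_⟩
  rw [LHom.realize_onFormula, ← LHom.realize_onFormula g]
  exact hφψ x

theorem HasQE.nameConstants_of_empty {R : Type*} [Ring R] {n : ℕ} {e : Fin n → Fin n → R}
    {S : FirstOrder.Language.empty.Structure R}
    (h : HasQE (nameConstants (ringExpansion R S) e)) :
    HasQE (nameConstants (ringStructure R) e) := by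
  let := nameConstants (ringExpansion R S) e
  let := nameConstants (ringStructure R) e
  let f : (Language.ring.sum FirstOrder.Language.empty).withConstants (Fin n × Fin n) →ᴸ
      Language.ring.withConstants (Fin n × Fin n) :=
    LHom.sumMap (LHom.sumElim (LHom.id _) (LHom.ofIsEmpty _ _)) (LHom.id _)
  let g : Language.ring.withConstants (Fin n × Fin n) →ᴸ
      (Language.ring.sum FirstOrder.Language.empty).withConstants (Fin n × Fin n) :=
    LHom.sumMap LHom.sumInl (LHom.id _)
  have : f.IsExpansionOn R := by
    constructor <;> rintro k ((s | s) | s) x <;> first | rfl | exact isEmptyElim s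
  have : g.IsExpansionOn R := by
    constructor <;> rintro k (s | s) x <;> rfl
  exact h.of_lhom f g

theorem hasQE_stdUnits_of_isAlgClosed (K : Type*) [Field K] [IsAlgClosed K] (n : ℕ) [NeZero n] :
    HasQE (nameConstants (ringStructure (Matrix (Fin n) (Fin n) K)) (stdUnits K n)) :=
  (hasQE_nameConstants_stdUnits _ (hasQE_of_isAlgClosed K emptyStructure)).nameConstants_of_empty

end Examples

end MatrixQE

theorem mainTheorem5 (n : ℕ) (hn : 0 < n) :
    (∀ (L : FirstOrder.Language.{u, v}) (F : Type w) [Field F] (S : L.Structure F),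
      MatrixQE.HasQE (MatrixQE.ringExpansion F S) →
      ∀ e : Fin n → Fin n → Matrix (Fin n) (Fin n) F, MatrixQE.IsMatrixUnits e →
        MatrixQE.HasQE (MatrixQE.nameConstants (MatrixQE.matrixExpansion S n) e)) ∧
    MatrixQE.HasQE (MatrixQE.nameConstants
      (MatrixQE.ringStructure (Matrix (Fin n) (Fin n) ℂ)) (MatrixQE.stdUnits ℂ n)) ∧
    MatrixQE.HasQE (MatrixQE.nameConstants
      (MatrixQE.matrixExpansion (FirstOrder.Language.orderStructure ℝ) n)
      (MatrixQE.stdUnits ℝ n)) := by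
  have : NeZero n := ⟨hn.ne'⟩
  exact ⟨fun L F _ S hF e he =>
      he.hasQE_nameConstants S (MatrixQE.hasQE_nameConstants_stdUnits S hF),
    MatrixQE.hasQE_stdUnits_of_isAlgClosed ℂ n,
    MatrixQE.hasQE_nameConstants_stdUnits _ MatrixQE.hasQE_real⟩
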